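/- A surface-knot is a closed connected oriented smooth surface $F$ embedded in $\mathbb{R}^4$. Its diagram $D$ is the image of $F$ under a generic projection $\mathbb{R}^4\to\mathbb{R}^3$ (locally one, two or three transverse sheets, or a Whitney umbrella; branch points are allowed), together with the orientation, recorded by a normal direction $\vec n$ such that $(\vec v_1,\vec v_2,\vec n)$ is positive in $\mathbb{R}^3$ for every positive tangent frame $(\vec v_1,\vec v_2)$, and the over/under information at multiple points given by the fourth coordinate. The sheets of $D$ are the connected components obtained by cutting $F$ along the double point curves in the lower disks. A rack is a set $R$ with a binary operation $*$ such that every map $\bullet\mapsto\bullet*b$ is bijective and $(a*b)*c=(a*c)*(b*c)$ for all $a,b,c$. A rack coloring of $D$ by $R$ is a map $c$ from the set of sheets of $D$ to $R$ such that, along every double point curve, $c(x_k)=c(x_i)*c(x_j)$, where $x_j$ is the over-sheet and $x_i,x_k$ are the under-sheets, the normal direction of $x_j$ pointing from $x_i$ to $x_k$. Let $\mathrm{Col}_R(D)$ be the set of rack colorings of $D$ by $R$. Two diagrams are regular-equivalent if they are related by a finite sequence of ambient isotopies of $\mathbb{R}^3$ and the following branch-free Roseman moves and their inverses. Each move is supported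 in a coordinate box of $\mathbb{R}^3$ with coordinates $x,y,z$, in which, for a parameter $t$ which changes its sign (and is cut off to $0$ near the boundary of the box), the diagram consists of the following disks, with any fixed order of heights and any fixed orientations. * $D1$: $z=0$ and $z=x^2+y^2+t$. * $D2$: $z=0$ and $z=x^2-y^2+t$. * $T1$: $z=0$, $y=0$ and $y+z=x^2+t$. * $T2$: $x=0$, $y=0$, $z=0$ and $x+y+z=t$. **Theorem.** Let $D_1$ and $D_2$ be two diagrams of a surface-knot. If $D_1$ and $D_2$ are regular-equivalent, then for every rack $R$ there is a bijection between $\mathrm{Col}_R(D_1)$ and $\mathrm{Col}_R(D_2)$. -/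

import Mathlib

open scoped ContDiff

namespace SurfaceKnots

/-! Only the topological and smooth structures of `ℝ², ℝ³, ℝ⁴` are used below, so plain products
are used as models. The projection `ℝ⁴ → ℝ³` is `Prod.fst`; the height, that is, the fourth
coordinate dropped by the projection, is `Prod.snd`. -/

abbrev R2 := Fin 2 → ℝ

abbrev R3 := Fin 3 → ℝ

abbrev R4 := R3 × ℝ

/-- A surface-knot: a compact connected smooth surface embedded in `ℝ⁴`, without boundary and
oriented, given by an oriented atlas of smooth local parametrizations. -/
structure SurfaceKnot where
  carrier : Set R4
  isCompact_carrier : IsCompact carrier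
  isConnected_carrier : IsConnected carrier
  /-- the local parametrizations of the oriented atlas -/
  params : Set (R2 → R4)
  contDiff_param : ∀ ψ ∈ params, ContDiff ℝ ∞ ψ
  immersive_param : ∀ ψ ∈ params, ∀ u, Function.Injective (fderiv ℝ ψ u)
  isEmbedding_param : ∀ ψ ∈ params, Topology.IsEmbedding ψ
  range_param : ∀ ψ ∈ params, ∃ V : Set R4, IsOpen V ∧ Set.range ψ = V ∩ carrier
  cover : ∀ p ∈ carrier, ∃ ψ ∈ params, p ∈ Set.range ψ
  /-- the parametrizations induce the same orientation on every tangent plane -/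
  oriented : ∀ ψ ∈ params, ∀ ψ' ∈ params, ∀ u v, ψ u = ψ' v →
    ∃ A : R2 →L[ℝ] R2, 0 < A.det ∧ fderiv ℝ ψ u = (fderiv ℝ ψ' v).comp A

/-- For a positively oriented basis `v₁, v₂` of the tangent plane at `p`, the vector `w` of `ℝ³`
points to the same side of the projected tangent plane as the normal direction `n = v₁ × v₂`, for
which `(v₁, v₂, n)` matches the orientation of `ℝ³`. (No `w` qualifies where the projection is
not an immersion, since `v₁ × v₂ = 0` there.) -/
def SurfaceKnot.PositiveSide (K : SurfaceKnot) (p : R4) (w : R3) : Prop :=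
  ∃ ψ ∈ K.params, ∃ u : R2, ψ u = p ∧
    0 < (crossProduct (fderiv ℝ ψ u ![1, 0]).1 (fderiv ℝ ψ u ![0, 1]).1) ⬝ᵥ w

/-- `φ` is a smooth local coordinate system of `ℝ³`. -/
def IsSmoothChart (φ : OpenPartialHomeomorph R3 R3) : Prop :=
  ContDiffOn ℝ ∞ φ φ.source ∧ ContDiffOn ℝ ∞ φ.symm φ.target

/-- The part of the surface `K` over the domain of the chart `φ` consists of finitely many pieces
indexed by `ι`: in the coordinates `φ`, the `i`-th piece is the graph of the smooth height
function `H i` over the surface `{g i = 0}`. Different pieces have different heights. -/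
def IsGraphs {ι : Type} (K : Set R4) (φ : OpenPartialHomeomorph R3 R3)
    (g : ι → R3 → ℝ) (H : ι → R3 → ℝ) : Prop :=
  (∀ i, ContDiffOn ℝ ∞ (H i) φ.source) ∧
  (∀ i j, i ≠ j → ∀ q ∈ φ.source, H i q ≠ H j q) ∧
  ∀ p : R4, p.1 ∈ φ.source → (p ∈ K ↔ ∃ i, g i (φ p.1) = 0 ∧ p.2 = H i p.1)

/-- Near the point `q` of `ℝ³`, the projection of `K` looks like `m` coordinate planes with
`m ≤ 3` (a regular point, a double point or a triple point, for `m = 1, 2, 3`). -/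
def IsCrossingPoint (K : Set R4) (q : R3) : Prop :=
  ∃ φ : OpenPartialHomeomorph R3 R3, IsSmoothChart φ ∧ q ∈ φ.source ∧ φ q = 0 ∧
    ∃ (m : ℕ) (hm : m ≤ 3) (H : Fin m → R3 → ℝ),
      IsGraphs K φ (fun i v => v (Fin.castLE hm i)) H

/-- Near the point `q` of `ℝ³`, the projection of `K` looks like the Whitney umbrella
`(a, b) ↦ (a², ab, b)`. -/
def IsBranchPoint (K : Set R4) (q : R3) : Prop :=
  ∃ φ : OpenPartialHomeomorph R3 R3, IsSmoothChart φ ∧ q ∈ φ.source ∧ φ q = 0 ∧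
    ∃ H : ℝ × ℝ → ℝ, ContDiff ℝ ∞ H ∧
      ∀ p : R4, p.1 ∈ φ.source →
        (p ∈ K ↔ ∃ a b : ℝ, φ p.1 = ![a ^ 2, a * b, b] ∧ p.2 = H (a, b))

/-- A surface-knot diagram, presented by a surface-knot for which the projection `ℝ⁴ → ℝ³` is
generic. Only the image of the projection, the orientation and the height order at the multiple
points matter: presentations that agree in these are identified in `AmbientIsotopic`. -/
structure Diagram extends SurfaceKnot where
  generic : ∀ p ∈ carrier, IsCrossingPoint carrier p.1 ∨ IsBranchPoint carrier p.1

namespace Diagram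

variable (D : Diagram)

/-- The points of the surface that lie below another point of the surface. -/
def lower : Set R4 :=
  {p | p ∈ D.carrier ∧ ∃ p' ∈ D.carrier, p'.1 = p.1 ∧ p.2 < p'.2}

/-- The surface cut open along the double point curves in the lower disks. -/
def cutSurface : Set R4 := D.carrier \ closure D.lower

/-- The sheets: the connected components of the surface, cut along the double point curves in the
lower disks. -/
def Sheet : Type :=
  {S : Set R4 // ∃ p ∈ D.cutSurface, S = connectedComponentIn D.cutSurface p}

/-- At some point of a double point curve, `xj` is the over-sheet, `xi` and `xk` are the
under-sheets, and the normal direction of `xj` points from `xi` to `xk`. Here `x` and `y` are the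
upper and the lower point over the double point, and `γ` is a curve on the surface through `y`
whose projection to `ℝ³` crosses the upper disk transversely, in its normal direction. -/
def Adjacent (xi xj xk : D.Sheet) : Prop :=
  ∃ x y : R4, {p | p ∈ D.carrier ∧ p.1 = x.1} = {x, y} ∧ y.2 < x.2 ∧ x ∈ xj.1 ∧
    ∃ (γ : ℝ → R4) (w : R3), γ 0 = y ∧ ContinuousAt γ 0 ∧ (∀ᶠ t in nhds (0 : ℝ), γ t ∈ D.carrier) ∧
      HasDerivAt (fun t => (γ t).1) w 0 ∧ D.PositiveSide x w ∧
      ∀ᶠ t in nhdsWithin (0 : ℝ) (Set.Ioi 0), γ (-t) ∈ xi.1 ∧ γ t ∈ xk.1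

end Diagram

/-- Rack colorings of the diagram `D` by the rack `R`. The operation `a * b` of a rack, for which
`· * b` is bijective and `(a * b) * c = (a * c) * (b * c)`, is `b ◃ a` in Mathlib's notation. -/
def RackColoring (R : Type*) [Rack R] (D : Diagram) : Type _ :=
  {c : D.Sheet → R // ∀ xi xj xk, D.Adjacent xi xj xk → c xk = Shelf.act (c xj) (c xi)}

/-- `D` and `D'` are the same diagram up to a smooth ambient isotopy of `ℝ³`: the final map `Φ 1`
of the isotopy carries the projected surface to the projected surface, preserving the height order
at multiple points and the orientation. (`Φ 1` preserves the orientation of `ℝ³`, so it is enough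
to look at normal directions.) -/
def AmbientIsotopic (D D' : Diagram) : Prop :=
  ∃ Φ Ψ : ℝ → R3 → R3,
    ContDiff ℝ ∞ (Function.uncurry Φ) ∧ ContDiff ℝ ∞ (Function.uncurry Ψ) ∧
    (∀ t, Function.LeftInverse (Ψ t) (Φ t) ∧ Function.RightInverse (Ψ t) (Φ t)) ∧
    Φ 0 = id ∧
    ∃ e : D.carrier ≃ₜ D'.carrier,
      (∀ p, (e p).1.1 = Φ 1 p.1.1) ∧
      (∀ p p' : D.carrier, p.1.1 = p'.1.1 → (p.1.2 < p'.1.2 ↔ (e p).1.2 < (e p').1.2)) ∧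
      ∀ (p : D.carrier) (w : R3),
        D.PositiveSide p w ↔ D'.PositiveSide (e p) (fderiv ℝ (Φ 1) p.1.1 w)

/-- The four branch-free types of Roseman moves. -/
inductive MoveType
  | D1
  | D2
  | T1
  | T2

/-- The number of disks that take part in a move. -/
def MoveType.disks : MoveType → ℕ
  | .D1 => 2
  | .D2 => 2
  | .T1 => 3
  | .T2 => 4

/-- A smooth cut-off function: `1` if `x² + y² ≤ 1`, and `0` if `x² + y² ≥ 2`. -/
noncomputable def bump (v : R3) : ℝ := Real.smoothTransition (2 - (v 0 ^ 2 + v 1 ^ 2))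

/-- The box in which the local models of the moves live. -/
def box : Set R3 := {v | |v 0| < 2 ∧ |v 1| < 2 ∧ |v 2| < 10}

/-- Equations in the coordinates `x, y, z` of the box for the disks in the local model of a move,
at time `t`. The critical moment is `t = 0`; the move goes from `t = 1/8` to `t = -1/8` or back.
- `D1`: the disk `z = x² + y² + t` is pushed through `z = 0` and a double point circle is born.
- `D2`: the disk `z = x² - y² + t` is pushed through `z = 0` and two double point arcs undergo a
  saddle move.
- `T1`: the disk `y + z = x² + t` is pushed through the double point line `y = z = 0` and a pair
  of triple points is born.
- `T2`: the disk `x + y + z = t` is pushed through the triple point of the coordinate planes.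
In each case `t` is cut off so that nothing moves near the boundary of the box. -/
noncomputable def MoveType.model : (m : MoveType) → ℝ → Fin m.disks → R3 → ℝ
  | .D1, t => ![fun v => v 2, fun v => v 2 - (v 0 ^ 2 + v 1 ^ 2 + t * bump v)]
  | .D2, t => ![fun v => v 2, fun v => v 2 - (v 0 ^ 2 - v 1 ^ 2 + t * bump v)]
  | .T1, t => ![fun v => v 2, fun v => v 1, fun v => v 1 + v 2 - (v 0 ^ 2 + t * bump v)]
  | .T2, t => ![fun v => v 0, fun v => v 1, fun v => v 2,
      fun v => v 0 + v 1 + v 2 - t * bump v]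

/-- The normal direction of the `i`-th piece of `K` over the chart `φ` (see `IsGraphs`) is the one
in which `s i * g i` increases, in the coordinates `φ`. -/
def HasNormals {ι : Type} (K : SurfaceKnot) (φ : OpenPartialHomeomorph R3 R3)
    (g : ι → R3 → ℝ) (H : ι → R3 → ℝ) (s : ι → ℤˣ) : Prop :=
  ∀ p ∈ K.carrier, p.1 ∈ φ.source → ∀ i, g i (φ p.1) = 0 → p.2 = H i p.1 →
    ∀ w, K.PositiveSide p w ↔ 0 < ((s i : ℤ) : ℝ) * fderiv ℝ (g i ∘ φ) p.1 w

/-- `D'` is obtained from `D` by a Roseman move of type `m`: there is a coordinate box `φ` in `ℝ³`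
over which `D` and `D'` are the local model before and after the move, where the disks have any
fixed height order and any fixed orientations, and outside of which `D` and `D'` agree. -/
def Move (m : MoveType) (D D' : Diagram) : Prop :=
  ∃ φ : OpenPartialHomeomorph R3 R3, IsSmoothChart φ ∧ φ.target = box ∧
    ∃ (H : Fin m.disks → R3 → ℝ) (s : Fin m.disks → ℤˣ),
      IsGraphs D.carrier φ (m.model (1 / 8)) H ∧
      IsGraphs D'.carrier φ (m.model (-1 / 8)) H ∧
      HasNormals D.toSurfaceKnot φ (m.model (1 / 8)) H s ∧
      HasNormals D'.toSurfaceKnot φ (m.model (-1 / 8)) H s ∧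
      ∀ p : R4, p.1 ∉ φ.source →
        (p ∈ D.carrier ↔ p ∈ D'.carrier) ∧
        ∀ w, D.PositiveSide p w ↔ D'.PositiveSide p w

/-- Two diagrams are regular-equivalent if they are related by a finite sequence of ambient
isotopies of `ℝ³` and branch-free Roseman moves and their inverses. -/
def RegularEquivalent : Diagram → Diagram → Prop :=
  Relation.EqvGen fun D D' => AmbientIsotopic D D' ∨ ∃ m, Move m D D'

end SurfaceKnots

/-! A rack coloring amounts to a locally constant function on the cut surface that obeys the
coloring condition along every curve crossing transversely below a double point
(`RackColoring.exists_of_isLocallyConstant`, `RackColoring.eventually_crosses`). In this form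
colorings can be transported by homeomorphisms, which settles ambient isotopies
(`Carries.nonempty_equiv`), and glued from local data, which is used for the moves.

Over the box of a move, number the disks from the top and choose equations `g i` increasing in the
normal directions. Attach a base color `a i` to each disk, and color a point of the `i`-th disk by
letting those `a j` with `j < i` and `0 < g j` act on `a i`, the topmost last (`diskColor`). By
self-distributivity the composite `ρ` of such actions is a rack automorphism, so conjugating the
action of `a j` by `ρ` gives the action of `ρ (a j)`: crossing the `j`-th disk acts by its actual
color at that point (`passage_eq_act`). Hence any base colors give a coloring over the box.
Conversely, every coloring comes from unique base colors (`exists_hasBaseColors`,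
`baseColors_unique`): undoing the actions on one disk leaves a function that is constant near every
point outside a countable set, and a disk stays connected without a countable set.

The colors depend only on `a` and the signs of the `g i`, and a move changes these signs only inside
a compact part of the box. Keeping the base colors inside and the coloring outside is therefore a
bijection (`IsLocalChange.nonempty_equiv`). The particular moves enter only through the
connectedness of punctured disks, the countability of higher multiple points and the comparison of
signs. -/

namespace SurfaceKnots

open Set Filter Topology

/-! ### Sheets and crossing curves -/

namespace Diagram

variable (D : Diagram)

/-- The sheet through a point of the cut surface. -/
def sheet (p : R4) (hp : p ∈ D.cutSurface) : D.Sheet :=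
  ⟨connectedComponentIn D.cutSurface p, p, hp, rfl⟩

variable {D}

theorem mem_sheet {p : R4} (hp : p ∈ D.cutSurface) : p ∈ (D.sheet p hp).1 :=
  mem_connectedComponentIn hp

theorem Sheet.subset (S : D.Sheet) : S.1 ⊆ D.cutSurface := by
  obtain ⟨_, p, hp, rfl⟩ := S
  exact connectedComponentIn_subset _ _

theorem Sheet.eq_sheet (S : D.Sheet) {p : R4} (hp : p ∈ S.1) : S = D.sheet p (S.subset hp) := by
  obtain ⟨_, q, hq, rfl⟩ := S
  exact Subtype.ext (connectedComponentIn_eq hp)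

theorem sheet_eq_of_isPreconnected {s : Set R4} (hs : IsPreconnected s) (hsub : s ⊆ D.cutSurface)
    {p q : R4} (hp : p ∈ s) (hq : q ∈ s) : D.sheet p (hsub hp) = D.sheet q (hsub hq) :=
  ((D.sheet p (hsub hp)).eq_sheet (hs.subset_connectedComponentIn hp hsub hq))

theorem notMem_lower_of_mem_cutSurface {p : R4} (hp : p ∈ D.cutSurface) : p ∉ D.lower :=
  fun h => hp.2 (subset_closure h)

/-- Sheets are relatively open in the cut surface. -/
theorem eventually_sheet_eq {p : R4} (hp : p ∈ D.cutSurface) :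
    ∀ᶠ q in 𝓝 p, ∀ hq : q ∈ D.cutSurface, D.sheet q hq = D.sheet p hp := by
  obtain ⟨χ, hχ, u, rfl⟩ := D.cover p hp.1
  obtain ⟨V, hV, hr⟩ := D.range_param χ hχ
  have hemb := D.isEmbedding_param χ hχ
  have hO : χ ⁻¹' (closure D.lower)ᶜ ∈ 𝓝 u :=
    hemb.continuous.continuousAt.preimage_mem_nhds (isClosed_closure.isOpen_compl.mem_nhds hp.2)
  obtain ⟨r, hr0, hball⟩ := Metric.mem_nhds_iff.1 hO
  obtain ⟨O, hOo, hOeq⟩ := hemb.isInducing.isOpen_iff.1 (Metric.isOpen_ball (x := u) (ε := r))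
  have hu : u ∈ Metric.ball u r := Metric.mem_ball_self hr0
  have hpV : χ u ∈ V := (hr ▸ mem_range_self u : χ u ∈ V ∩ D.carrier).1
  have hpO : χ u ∈ O := by rw [← hOeq] at hu; exact hu
  -- A small parametrized disk misses the closed set `closure D.lower`, so its connected image lies
  -- in a single sheet.
  have hsub : χ '' Metric.ball u r ⊆ D.cutSurface := by
    rintro _ ⟨v, hv, rfl⟩
    exact ⟨(hr ▸ mem_range_self v : χ v ∈ V ∩ D.carrier).2, hball hv⟩
  have hpre : IsPreconnected (χ '' Metric.ball u r) :=
    ((convex_ball u r).isPreconnected).image _ hemb.continuous.continuousOn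
  filter_upwards [hOo.mem_nhds hpO, hV.mem_nhds hpV] with q hqO hqV hq
  obtain ⟨v, rfl⟩ : q ∈ range χ := hr ▸ ⟨hqV, hq.1⟩
  have hv : v ∈ Metric.ball u r := by rw [← hOeq]; exact hqO
  exact sheet_eq_of_isPreconnected hpre hsub (mem_image_of_mem _ hv) (mem_image_of_mem _ hu)

/-- `γ` is a curve on the surface through the lower point `y` below `x`, and its projection crosses
the upper disk at `x` transversely, in its normal direction, with velocity `w`. -/
structure Crosses (D : Diagram) (x y : R4) (γ : ℝ → R4) (w : R3) : Prop where
  fibre : {p | p ∈ D.carrier ∧ p.1 = x.1} = {x, y}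
  lt : y.2 < x.2
  zero : γ 0 = y
  cont : ContinuousAt γ 0
  mem : ∀ᶠ t in 𝓝 (0 : ℝ), γ t ∈ D.carrier
  deriv : HasDerivAt (fun t => (γ t).1) w 0
  side : D.PositiveSide x w

namespace Crosses

variable {x y : R4} {γ : ℝ → R4} {w : R3}

theorem mem_upper (h : D.Crosses x y γ w) : x ∈ D.carrier :=
  (h.fibre.symm ▸ mem_insert x {y} : x ∈ {p | p ∈ D.carrier ∧ p.1 = x.1}).1

theorem mem_lower (h : D.Crosses x y γ w) : y ∈ D.carrier :=
  (h.fibre.symm ▸ mem_insert_of_mem x rfl : y ∈ {p | p ∈ D.carrier ∧ p.1 = x.1}).1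

theorem fst_eq (h : D.Crosses x y γ w) : y.1 = x.1 :=
  (h.fibre.symm ▸ mem_insert_of_mem x rfl : y ∈ {p | p ∈ D.carrier ∧ p.1 = x.1}).2

theorem eq_or_eq (h : D.Crosses x y γ w) {p : R4} (hp : p ∈ D.carrier) (hpx : p.1 = x.1) :
    p = x ∨ p = y :=
  (h.fibre ▸ ⟨hp, hpx⟩ : p ∈ ({x, y} : Set R4))

end Crosses

theorem adjacent_iff {xi xj xk : D.Sheet} : D.Adjacent xi xj xk ↔
    ∃ x y γ w, D.Crosses x y γ w ∧ x ∈ xj.1 ∧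
      ∀ᶠ t in 𝓝[>] (0 : ℝ), γ (-t) ∈ xi.1 ∧ γ t ∈ xk.1 := by
  constructor
  · rintro ⟨x, y, h1, h2, h3, γ, w, h4, h5, h6, h7, h8, h9⟩
    exact ⟨x, y, γ, w, ⟨h1, h2, h4, h5, h6, h7, h8⟩, h3, h9⟩
  · rintro ⟨x, y, γ, w, ⟨h1, h2, h4, h5, h6, h7, h8⟩, h3, h9⟩
    exact ⟨x, y, h1, h2, h3, γ, w, h4, h5, h6, h7, h8, h9⟩

end Diagram

/-! ### Colorings as locally constant functions -/

namespace RackColoring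

variable {R : Type*} [Rack R] {D : Diagram}

theorem ext_sheet {c c' : RackColoring R D}
    (h : ∀ p hp, c.1 (D.sheet p hp) = c'.1 (D.sheet p hp)) : c = c' := by
  refine Subtype.ext (funext fun S => ?_)
  obtain ⟨_, p, hp, rfl⟩ := S
  exact h p hp

/-- A locally constant function on the cut surface that satisfies the coloring condition along
every curve crossing below the surface comes from a rack coloring. -/
theorem exists_of_isLocallyConstant (f : D.cutSurface → R) (hf : IsLocallyConstant f)
    (hcross : ∀ x y γ w, D.Crosses x y γ w → ∀ hx : x ∈ D.cutSurface,
      ∀ᶠ t in 𝓝[>] (0 : ℝ), ∀ (h₁ : γ (-t) ∈ D.cutSurface) (h₂ : γ t ∈ D.cutSurface),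
        f ⟨γ t, h₂⟩ = Shelf.act (f ⟨x, hx⟩) (f ⟨γ (-t), h₁⟩)) :
    ∃ c : RackColoring R D, ∀ p hp, c.1 (D.sheet p hp) = f ⟨p, hp⟩ := by
  have key : ∀ (S : D.Sheet) (p q : R4) (hp : p ∈ S.1) (hq : q ∈ S.1),
      f ⟨p, S.subset hp⟩ = f ⟨q, S.subset hq⟩ := by
    rintro ⟨_, z, hz, rfl⟩ p q hp hq
    have hpre : IsPreconnected
        ((↑) ⁻¹' connectedComponentIn D.cutSurface z : Set D.cutSurface) := by
      rw [← Topology.IsInducing.subtypeVal.isPreconnected_image, Subtype.image_preimage_coe,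
        inter_eq_right.2 (connectedComponentIn_subset _ _)]
      exact isPreconnected_connectedComponentIn
    exact hf.apply_eq_of_isPreconnected hpre hp hq
  have hne : ∀ S : D.Sheet, ∃ p, p ∈ S.1 := by
    rintro ⟨_, z, hz, rfl⟩
    exact ⟨z, mem_connectedComponentIn hz⟩
  choose pt hpt using hne
  have hval : ∀ (S : D.Sheet) p (hp : p ∈ S.1), f ⟨pt S, S.subset (hpt S)⟩ = f ⟨p, S.subset hp⟩ :=
    fun S p hp => key S _ _ (hpt S) hp
  refine ⟨⟨fun S => f ⟨pt S, S.subset (hpt S)⟩, fun xi xj xk hadj => ?_⟩,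
    fun p hp => hval _ p (Diagram.mem_sheet hp)⟩
  obtain ⟨x, y, γ, w, hc, hx, ht⟩ := Diagram.adjacent_iff.1 hadj
  obtain ⟨t, ⟨h₁, h₂⟩, h₃⟩ := (ht.and (hcross x y γ w hc (xj.subset hx))).exists
  dsimp only
  rw [hval xi _ h₁, hval xk _ h₂, hval xj _ hx]
  exact h₃ _ _

theorem isLocallyConstant (c : RackColoring R D) :
    IsLocallyConstant fun p : D.cutSurface => c.1 (D.sheet p.1 p.2) := by
  rw [IsLocallyConstant.iff_eventually_eq]
  intro p
  have := (Diagram.eventually_sheet_eq p.2)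
  filter_upwards [continuousAt_subtype_val.eventually this] with q hq
  rw [hq q.2]

end RackColoring

/-! ### Normal directions and positive sides -/

theorem crossProduct_map_map (L : R2 →L[ℝ] R3) (A : R2 →L[ℝ] R2) :
    crossProduct (L (A ![1, 0])) (L (A ![0, 1])) =
      A.det • crossProduct (L ![1, 0]) (L ![0, 1]) := by
  have hdec : ∀ v : R2, L v = v 0 • L ![1, 0] + v 1 • L ![0, 1] := by
    intro v
    rw [← map_smul, ← map_smul, ← map_add]
    congr 1
    ext i; fin_cases i <;> simp
  have hdet : A.det = A ![1, 0] 0 * A ![0, 1] 1 - A ![0, 1] 0 * A ![1, 0] 1 := by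
    have h0 : (Pi.single 0 1 : R2) = ![1, 0] := by ext i; fin_cases i <;> simp
    have h1 : (Pi.single 1 1 : R2) = ![0, 1] := by ext i; fin_cases i <;> simp
    rw [ContinuousLinearMap.det, ← LinearMap.det_toMatrix', Matrix.det_fin_two]
    simp [LinearMap.toMatrix'_apply, h0, h1]
  rw [hdec (A ![1, 0]), hdec (A ![0, 1]), hdet]
  ext i
  fin_cases i <;> simp [crossProduct] <;> ring

/-- Vectors off the tangent plane spanned by `a, b` are measured by the normal `a × b`. -/
theorem dual_mul_dotProduct_cross (ℓ : R3 →L[ℝ] ℝ) {a b : R3} (ha : ℓ a = 0) (hb : ℓ b = 0)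
    (w : R3) : ℓ w * (crossProduct a b ⬝ᵥ crossProduct a b) =
      (crossProduct a b ⬝ᵥ w) * ℓ (crossProduct a b) := by
  set n := crossProduct a b with hn
  -- Expansion of `w` in the frame `a, b, n`, cleared of the denominator `n ⬝ᵥ n`.
  have key : (n ⬝ᵥ n) • w = (crossProduct b n ⬝ᵥ w) • a + (crossProduct n a ⬝ᵥ w) • b
      + (n ⬝ᵥ w) • n := by
    ext i
    rw [hn]
    fin_cases i <;> simp [crossProduct, dotProduct, Fin.sum_univ_three] <;> ring
  have := congrArg ℓ key
  simp only [map_add, map_smul, ha, hb, smul_eq_mul, mul_zero, zero_add] at this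
  rw [mul_comm, this]

/-- If near the point `p` the surface is a graph, with slope `η`, over a surface in `ℝ³` with
tangent plane `ker ℓ`, then the positive side at `p` is one side of `ker ℓ`. -/
theorem SurfaceKnot.exists_positiveSide_iff (K : SurfaceKnot) {p : R4} (hp : p ∈ K.carrier)
    {ℓ η : R3 →L[ℝ] ℝ} (hℓ : ℓ ≠ 0)
    (htan : ∀ ψ ∈ K.params, ∀ u, ψ u = p → ∀ e,
      ℓ (fderiv ℝ ψ u e).1 = 0 ∧ (fderiv ℝ ψ u e).2 = η (fderiv ℝ ψ u e).1) :
    ∃ ε : ℝ, ε ≠ 0 ∧ ∀ w, K.PositiveSide p w ↔ 0 < ε * ℓ w := by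
  obtain ⟨χ, hχ, u, hu⟩ := K.cover p hp
  set L : R2 →L[ℝ] R3 := (ContinuousLinearMap.fst ℝ R3 ℝ).comp (fderiv ℝ χ u) with hL
  set n := crossProduct (L ![1, 0]) (L ![0, 1]) with hn
  -- The fourth coordinate of a tangent vector is determined by its projection through `η`, so the
  -- projection is still immersive here.
  have hn0 : n ≠ 0 := by
    rw [hn, crossProduct_ne_zero_iff_linearIndependent, LinearIndependent.pair_iff]
    intro s t hst
    rw [← map_smul, ← map_smul, ← map_add] at hst
    have h1 : (fderiv ℝ χ u (s • ![1, 0] + t • ![0, 1])).1 = 0 := hst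
    have h2 : (fderiv ℝ χ u (s • ![1, 0] + t • ![0, 1])).2 = 0 := by
      rw [(htan χ hχ u hu _).2, h1, map_zero]
    have h3 : (s • ![1, 0] + t • ![0, 1] : R2) = 0 :=
      K.immersive_param χ hχ u (by rw [map_zero]; exact Prod.ext h1 h2)
    exact ⟨by simpa using congrFun h3 0, by simpa using congrFun h3 1⟩
  have hnn : 0 < n ⬝ᵥ n := by
    have h0 : n ⬝ᵥ n ≠ 0 := fun h => hn0 (dotProduct_self_eq_zero.1 h)
    have h1 : 0 ≤ n ⬝ᵥ n := Finset.sum_nonneg fun i _ => mul_self_nonneg (n i)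
    exact lt_of_le_of_ne h1 h0.symm
  have hform : ∀ w, ℓ w * (n ⬝ᵥ n) = (n ⬝ᵥ w) * ℓ n := fun w =>
    dual_mul_dotProduct_cross ℓ (htan χ hχ u hu _).1 (htan χ hχ u hu _).1 w
  have hε : ℓ n ≠ 0 := by
    intro h
    refine hℓ (ContinuousLinearMap.ext fun w => ?_)
    have := hform w
    rw [h, mul_zero] at this
    exact (mul_eq_zero.1 this).resolve_right hnn.ne'
  have hside : ∀ w, K.PositiveSide p w ↔ 0 < n ⬝ᵥ w := by
    intro w
    constructor
    · rintro ⟨χ', hχ', u', hu', hpos⟩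
      obtain ⟨A, hA, hcomp⟩ := K.oriented χ' hχ' χ hχ u' u (hu'.trans hu.symm)
      have := crossProduct_map_map L A
      have h2 : ∀ e, (fderiv ℝ χ' u' e).1 = L (A e) := fun e => by rw [hcomp]; rfl
      rw [h2, h2, this, smul_dotProduct, smul_eq_mul] at hpos
      exact pos_of_mul_pos_right hpos hA.le
    · exact fun h => ⟨χ, hχ, u, hu, h⟩
  refine ⟨ℓ n, hε, fun w => ?_⟩
  rw [hside w]
  have h1 : (n ⬝ᵥ w) * (ℓ n * ℓ n) = (ℓ n * ℓ w) * (n ⬝ᵥ n) := by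
    rw [mul_assoc (ℓ n), hform w]; ring
  have h2 : 0 < ℓ n * ℓ n := mul_self_pos.2 hε
  constructor
  · intro h
    exact pos_of_mul_pos_left (h1 ▸ mul_pos h h2) hnn.le
  · intro h
    exact pos_of_mul_pos_left (h1.symm ▸ mul_pos h hnn) h2.le

/-! ### Local structure at a double point -/

section

namespace Diagram

variable {D : Diagram}

/-- Near a point `y` below exactly one other point `x` of the surface, the surface is cut into two
sides, on which a function `G` on `ℝ³` that increases in the normal direction at `x` is positive and
negative, respectively. -/
structure IsSideFunction (D : Diagram) (x y : R4) (G : R3 → ℝ) (G' : R3 →L[ℝ] ℝ) : Prop where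
  mem_cutSurface : x ∈ D.cutSurface
  zero : G x.1 = 0
  hasFDerivAt : HasFDerivAt G G' x.1
  side : ∀ w, D.PositiveSide x w ↔ 0 < G' w
  basis : ∀ V ∈ 𝓝 y, ∃ W ∈ 𝓝 y, W ⊆ V ∧
    (∀ p ∈ W, p ∈ D.carrier → G p.1 = 0 → p ∈ D.lower) ∧
    {p | p ∈ W ∧ p ∈ D.carrier ∧ 0 < G p.1} ⊆ D.cutSurface ∧
    {p | p ∈ W ∧ p ∈ D.carrier ∧ G p.1 < 0} ⊆ D.cutSurface ∧
    IsPreconnected {p | p ∈ W ∧ p ∈ D.carrier ∧ 0 < G p.1} ∧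
    IsPreconnected {p | p ∈ W ∧ p ∈ D.carrier ∧ G p.1 < 0}

/-- Genericity leaves one picture: the tip of an umbrella has only one point above it, and each
coordinate plane contributes its own point to the fibre, so exactly two planes cross. The coordinate
cutting out the upper plane, scaled by `ε`, is the side function; a straight line in the lower plane
gives the crossing curve. -/
theorem exists_isSideFunction {x y : R4} (hfib : {p | p ∈ D.carrier ∧ p.1 = x.1} = {x, y})
    (hlt : y.2 < x.2) :
    (∃ G G', D.IsSideFunction x y G G') ∧ ∃ γ w, D.Crosses x y γ w := by
  have hxm : x ∈ {p | p ∈ D.carrier ∧ p.1 = x.1} := hfib.symm ▸ mem_insert x {y}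
  have hym : y ∈ {p | p ∈ D.carrier ∧ p.1 = x.1} := hfib.symm ▸ mem_insert_of_mem x rfl
  have hx : x ∈ D.carrier := hxm.1
  obtain ⟨hy, hyx⟩ := hym
  rcases D.generic x hx with hcr | hbr
  swap
  · exfalso
    obtain ⟨φ, -, hq, hφ0, F, -, hF⟩ := hbr
    have huniq : ∀ p : R4, p ∈ D.carrier → p.1 = x.1 → p.2 = F (0, 0) := by
      intro p hp hpx
      obtain ⟨a, b, h1, h2⟩ := (hF p (hpx ▸ hq)).1 hp
      rw [hpx, hφ0] at h1
      have ha : a = 0 := by simpa using (congrFun h1 0).symm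
      have hb : b = 0 := by simpa using (congrFun h1 2).symm
      rw [h2, ha, hb]
    exact hlt.ne ((huniq y hy hyx).trans (huniq x hx rfl).symm)
  obtain ⟨φ, ⟨hsm, hsm'⟩, hq, hφ0, m, hm, H, hHs, hHne, hgr⟩ := hcr
  have hsrc : φ.source ∈ 𝓝 x.1 := φ.open_source.mem_nhds hq
  obtain ⟨j, hj0, hj⟩ := (hgr x hq).1 hx
  obtain ⟨i, hi0, hi⟩ := (hgr y (hyx ▸ hq)).1 hy
  rw [hyx] at hi
  have hlt0 : H i x.1 < H j x.1 := by rw [← hi, ← hj]; exact hlt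
  have hij : i ≠ j := fun h => hlt0.ne (by rw [h])
  have hall : ∀ k, k = i ∨ k = j := by
    intro k
    have hk : (x.1, H k x.1) ∈ D.carrier := (hgr (x.1, H k x.1) hq).2 ⟨k, by simp [hφ0], rfl⟩
    have h2 : ((x.1, H k x.1) : R4) ∈ ({x, y} : Set R4) := hfib ▸ ⟨hk, rfl⟩
    by_contra! hne
    rcases h2 with h2 | h2
    · exact hHne k j hne.2 _ hq (by rw [← hj, ← h2])
    · exact hHne k i hne.1 _ hq (by rw [← hi, ← h2])
  set ci := Fin.castLE hm i with hci
  set cj := Fin.castLE hm j with hcj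
  have hcij : ci ≠ cj := fun h => hij (Fin.castLE_injective hm h)
  have hHc : ∀ k, ContinuousOn (H k) φ.source := fun k => (hHs k).continuousOn
  have hHd : ∀ k, DifferentiableAt ℝ (H k) x.1 := fun k =>
    ((hHs k).contDiffAt hsrc).differentiableAt (by simp)
  have hφd : DifferentiableAt ℝ φ x.1 := (hsm.contDiffAt hsrc).differentiableAt (by simp)
  have htgt0 : (0 : R3) ∈ φ.target := hφ0 ▸ φ.map_source hq
  have hsymm0 : φ.symm 0 = x.1 := by rw [← hφ0, φ.left_inv hq]
  have hφsd : DifferentiableAt ℝ φ.symm 0 :=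
    (hsm'.contDiffAt (φ.open_target.mem_nhds htgt0)).differentiableAt (by simp)
  set ℓ : R3 →L[ℝ] ℝ := (ContinuousLinearMap.proj cj).comp (fderiv ℝ φ x.1) with hℓ
  have hℓd : HasFDerivAt (fun q => φ q cj) ℓ x.1 :=
    (ContinuousLinearMap.proj (R := ℝ) (φ := fun _ : Fin 3 => ℝ) cj).hasFDerivAt.comp x.1
      hφd.hasFDerivAt
  have hinv : ∀ v, fderiv ℝ φ x.1 (fderiv ℝ φ.symm 0 v) = v := by
    have h1 : HasFDerivAt (φ ∘ φ.symm) ((fderiv ℝ φ x.1).comp (fderiv ℝ φ.symm 0)) 0 :=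
      HasFDerivAt.comp 0 (by rw [hsymm0]; exact hφd.hasFDerivAt) hφsd.hasFDerivAt
    have h2 : HasFDerivAt (φ ∘ φ.symm) (ContinuousLinearMap.id ℝ R3) 0 := by
      refine (hasFDerivAt_id (0 : R3)).congr_of_eventuallyEq ?_
      filter_upwards [φ.open_target.mem_nhds htgt0] with v hv using φ.right_inv hv
    intro v
    exact congrArg (fun T : R3 →L[ℝ] R3 => T v) (h1.unique h2)
  have hℓ0 : ℓ ≠ 0 := by
    intro h
    have h1 : ℓ (fderiv ℝ φ.symm 0 (Pi.single cj 1)) = 1 := by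
      rw [hℓ, ContinuousLinearMap.comp_apply, hinv]; simp
    rw [h] at h1
    simp at h1
  -- the two heights near `x` and `y`
  have hsrc4 : ∀ z : R4, z.1 = x.1 → ∀ᶠ p : R4 in 𝓝 z, p.1 ∈ φ.source := fun z hz =>
    continuousAt_fst.eventually (by rw [hz]; exact hsrc)
  have hHcont : ∀ k, ∀ z : R4, z.1 = x.1 → ContinuousAt (fun p : R4 => H k p.1) z := fun k z hz =>
    ContinuousAt.comp (f := fun p : R4 => p.1) (by rw [hz]; exact (hHd k).continuousAt)
      continuousAt_fst
  have hup : ∀ᶠ p : R4 in 𝓝 x, H i p.1 < p.2 :=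
    (hHcont i x rfl).eventually_lt continuousAt_snd (by rw [hj]; exact hlt0)
  have hlo : ∀ᶠ p : R4 in 𝓝 y, p.2 < H j p.1 :=
    continuousAt_snd.eventually_lt (hHcont j y hyx) (by rw [hyx, hi]; exact hlt0)
  have hupper : ∀ᶠ p : R4 in 𝓝 x, p ∈ D.carrier → φ p.1 cj = 0 ∧ p.2 = H j p.1 := by
    filter_upwards [hup, hsrc4 x rfl] with p h1 h2 hp
    obtain ⟨k, hk1, hk2⟩ := (hgr p h2).1 hp
    rcases hall k with rfl | rfl
    · exact absurd hk2 h1.ne'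
    · exact ⟨hk1, hk2⟩
  obtain ⟨ε, hε, hside⟩ := D.exists_positiveSide_iff hx hℓ0 (η := fderiv ℝ (H j) x.1) (by
    intro ψ hψ u hu e
    have hψd : HasFDerivAt ψ (fderiv ℝ ψ u) u :=
      ((D.contDiff_param ψ hψ).differentiable (by simp) u).hasFDerivAt
    have hd1 : HasFDerivAt (fun v => (ψ v).1)
      ((ContinuousLinearMap.fst ℝ R3 ℝ).comp (fderiv ℝ ψ u)) u := hψd.fst
    have hd2 : HasFDerivAt (fun v => (ψ v).2)
      ((ContinuousLinearMap.snd ℝ R3 ℝ).comp (fderiv ℝ ψ u)) u := hψd.snd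
    have hmem : ∀ v, ψ v ∈ D.carrier := fun v => by
      obtain ⟨V, -, hV⟩ := D.range_param ψ hψ
      exact (hV ▸ mem_range_self v : ψ v ∈ V ∩ D.carrier).2
    have hev : ∀ᶠ v in 𝓝 u, φ (ψ v).1 cj = 0 ∧ (ψ v).2 = H j (ψ v).1 := by
      have := hψd.continuousAt.eventually (hu.symm ▸ hupper)
      filter_upwards [this] with v hv using hv (hmem v)
    have e1 : HasFDerivAt (fun v => φ (ψ v).1 cj)
        (ℓ.comp ((ContinuousLinearMap.fst ℝ R3 ℝ).comp (fderiv ℝ ψ u))) u :=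
      HasFDerivAt.comp (g := fun q => φ q cj) u (by rw [hu]; exact hℓd) hd1
    have e2 : HasFDerivAt (fun v => H j (ψ v).1)
        ((fderiv ℝ (H j) x.1).comp ((ContinuousLinearMap.fst ℝ R3 ℝ).comp (fderiv ℝ ψ u))) u :=
      HasFDerivAt.comp (g := H j) u (by rw [hu]; exact (hHd j).hasFDerivAt) hd1
    have e3 : HasFDerivAt (fun v => φ (ψ v).1 cj) (0 : R2 →L[ℝ] ℝ) u :=
      (hasFDerivAt_const (0 : ℝ) u).congr_of_eventuallyEq (hev.mono fun v hv => hv.1)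
    have e4 := hd2.unique (e2.congr_of_eventuallyEq (hev.mono fun v hv => hv.2))
    exact ⟨congrArg (fun T : R2 →L[ℝ] ℝ => T e) (e1.unique e3),
      congrArg (fun T : R2 →L[ℝ] ℝ => T e) e4⟩)
  -- the lower disk, parametrized
  set Γ : R3 → R4 := fun v => (φ.symm v, H i (φ.symm v)) with hΓ
  have hΓc : ContinuousOn Γ φ.target :=
    φ.continuousOn_symm.prodMk ((hHc i).comp φ.continuousOn_symm fun v hv => φ.map_target hv)
  have hΓ0 : Γ 0 = y := Prod.ext (hsymm0.trans hyx.symm) (by simp [hΓ, hsymm0, hi])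
  have hΓmem : ∀ v ∈ φ.target, v ci = 0 → Γ v ∈ D.carrier := fun v hv h0 =>
    (hgr _ (φ.map_target hv)).2 ⟨i, by simp only [hΓ]; rw [φ.right_inv hv]; exact h0, rfl⟩
  have hnotlower : ∀ p : R4, p.1 ∈ φ.source → p ∈ D.carrier → p.2 < H j p.1 → φ p.1 cj ≠ 0 →
      p ∈ D.cutSurface := by
    intro p hp hpK hpH hpj
    refine ⟨hpK, fun hcl => ?_⟩
    have hev : ∀ᶠ p' : R4 in 𝓝 p, p'.1 ∈ φ.source ∧ φ p'.1 cj ≠ 0 := by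
      refine (continuousAt_fst.eventually (φ.open_source.mem_nhds hp)).and ?_
      have : ContinuousAt (fun p' : R4 => φ p'.1 cj) p :=
        ((continuous_apply cj).continuousAt.comp (φ.continuousAt hp)).comp
          (f := fun p' : R4 => p'.1) continuousAt_fst
      exact this.eventually_ne hpj
    obtain ⟨p', ⟨⟨h1, h2⟩, h3, p'', h4, h5, h6⟩⟩ := (mem_closure_iff_frequently.1 hcl).and_eventually
      hev |>.exists.imp fun _ h => h.symm
    have hone : ∀ z : R4, z ∈ D.carrier → z.1 = p'.1 → z.2 = H i p'.1 := by
      intro z hz hz1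
      obtain ⟨k, hk1, hk2⟩ := (hgr z (hz1 ▸ h1)).1 hz
      rcases hall k with rfl | rfl
      · rw [hk2, hz1]
      · exact absurd (hz1 ▸ hk1) h2
    exact h6.ne ((hone _ h3 rfl).trans (hone _ h4 h5).symm)
  have hxcut : x ∈ D.cutSurface := by
    refine ⟨hx, fun hcl => ?_⟩
    have hH2 : ∀ᶠ p : R4 in 𝓝 x, H i p.1 < H j p.1 :=
      (hHcont i x rfl).eventually_lt (hHcont j x rfl) hlt0
    obtain ⟨p', ⟨⟨⟨h1, h2⟩, h0⟩, h3, p'', h4, h5, h6⟩⟩ :=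
      (mem_closure_iff_frequently.1 hcl).and_eventually
        ((hupper.and (hsrc4 x rfl)).and hH2) |>.exists.imp fun _ h => h.symm
    obtain ⟨k, hk1, hk2⟩ := (hgr p'' (h5.symm ▸ h2)).1 h4
    rw [(h1 h3).2, hk2, h5] at h6
    rcases hall k with rfl | rfl
    · exact h6.not_gt h0
    · exact h6.false
  refine ⟨⟨fun q => ε * φ q cj, ε • ℓ, hxcut, by simp [hφ0], hℓd.const_mul ε, hside, ?_⟩, ?_⟩
  · intro V hV
    have hΓV : ∀ᶠ v in 𝓝 (0 : R3), Γ v ∈ V ∧ H i (φ.symm v) < H j (φ.symm v) := by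
      have hc0 := hΓc.continuousAt (φ.open_target.mem_nhds htgt0)
      refine (hc0.eventually (hΓ0.symm ▸ hV)).and ?_
      have hk : ∀ k, ContinuousAt (fun v => H k (φ.symm v)) 0 := fun k =>
        ContinuousAt.comp (g := H k) (by rw [hsymm0]; exact (hHd k).continuousAt)
          hφsd.continuousAt
      exact (hk i).eventually_lt (hk j) (by rw [hsymm0]; exact hlt0)
    obtain ⟨δ, hδ, hball⟩ := Metric.eventually_nhds_iff_ball.1
      (hΓV.and (φ.open_target.eventually_mem htgt0))
    -- Below the upper disk only the lower disk remains, and it is parametrized by `Γ`; each side is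
    -- thus the image of a convex piece of a plane.
    have hWeq : ∀ s : Set ℝ, {p : R4 | (p ∈ V ∧ p.1 ∈ φ.source ∧ φ p.1 ∈ Metric.ball (0 : R3) δ ∧
        p.2 < H j p.1) ∧ p ∈ D.carrier ∧ ε * φ p.1 cj ∈ s} =
        Γ '' (Metric.ball 0 δ ∩ {v | v ci = 0} ∩ {v | ε * v cj ∈ s}) := by
      intro s
      ext p
      constructor
      · rintro ⟨⟨h1, h2, h3, h4⟩, h5, h6⟩
        obtain ⟨k, hk1, hk2⟩ := (hgr p h2).1 h5
        rcases hall k with rfl | rfl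
        · refine ⟨φ p.1, ⟨⟨h3, hk1⟩, h6⟩, ?_⟩
          simp only [hΓ]
          rw [φ.left_inv h2, ← hk2]
        · exact absurd hk2 h4.ne
      · rintro ⟨v, ⟨⟨h1, h2⟩, h3⟩, rfl⟩
        obtain ⟨⟨h4, h5⟩, h6⟩ := hball v h1
        refine ⟨⟨h4, φ.map_target h6, ?_, h5⟩, hΓmem v h6 h2, ?_⟩
        · simp only [hΓ]; rw [φ.right_inv h6]; exact h1
        · simp only [hΓ]; rw [φ.right_inv h6]; exact h3
    have hpre : ∀ s : Set ℝ, Convex ℝ s → IsPreconnected {p : R4 | (p ∈ V ∧ p.1 ∈ φ.source ∧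
        φ p.1 ∈ Metric.ball (0 : R3) δ ∧ p.2 < H j p.1) ∧ p ∈ D.carrier ∧ ε * φ p.1 cj ∈ s} := by
      intro s hs
      rw [hWeq]
      refine IsPreconnected.image ?_ _ (hΓc.mono fun v hv => (hball v hv.1.1).2)
      refine (((convex_ball _ _).inter ?_).inter ?_).isPreconnected
      · exact (convex_singleton (0 : ℝ)).linear_preimage (LinearMap.proj (R := ℝ) (φ := fun _ => ℝ) ci)
      · exact hs.linear_preimage (ε • LinearMap.proj (R := ℝ) (φ := fun _ => ℝ) cj)
    have hcut : ∀ p : R4, (p ∈ V ∧ p.1 ∈ φ.source ∧ φ p.1 ∈ Metric.ball (0 : R3) δ ∧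
        p.2 < H j p.1) → p ∈ D.carrier → ε * φ p.1 cj ≠ 0 → p ∈ D.cutSurface :=
      fun p h1 h2 h3 => hnotlower p h1.2.1 h2 h1.2.2.2 fun h => h3 (by rw [h, mul_zero])
    refine ⟨{p | p ∈ V ∧ p.1 ∈ φ.source ∧ φ p.1 ∈ Metric.ball (0 : R3) δ ∧ p.2 < H j p.1},
      ?_, fun p hp => hp.1, ?_, fun p hp => hcut p hp.1 hp.2.1 hp.2.2.ne',
      fun p hp => hcut p hp.1 hp.2.1 hp.2.2.ne, hpre _ (convex_Ioi 0), hpre _ (convex_Iio 0)⟩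
    · have hφc : ContinuousAt (fun p : R4 => φ p.1) y :=
        ContinuousAt.comp (f := fun p : R4 => p.1) (by rw [hyx]; exact hφd.continuousAt)
          continuousAt_fst
      have hb := hφc.eventually (p := fun v => v ∈ Metric.ball (0 : R3) δ)
        (by dsimp only; rw [hyx, hφ0]; exact Metric.ball_mem_nhds 0 hδ)
      filter_upwards [hV, hsrc4 y hyx, hb, hlo] with p h1 h2 h3 h4 using ⟨h1, h2, h3, h4⟩
    · rintro p ⟨h1, h2, h3, h4⟩ hp h0
      have h0' : φ p.1 cj = 0 := (mul_eq_zero.1 h0).resolve_left hε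
      exact ⟨hp, (p.1, H j p.1), (hgr (p.1, H j p.1) h2).2 ⟨j, h0', rfl⟩, rfl, h4⟩
  -- The factor `ε` in the direction makes the derivative of the side function `ε * ε`, positive for
  -- either sign of `ε`.
  · set v₀ : R3 := Pi.single cj ε with hv₀
    have hline : HasDerivAt (fun t : ℝ => t • v₀) v₀ 0 := by
      simpa using (hasDerivAt_id (0 : ℝ)).smul_const v₀
    have hline0 : Tendsto (fun t : ℝ => t • v₀) (𝓝 0) (𝓝 0) := by
      simpa using hline.continuousAt.tendsto
    refine ⟨fun t => Γ (t • v₀), fderiv ℝ φ.symm 0 v₀, hfib, hlt, by simp [hΓ0], ?_, ?_, ?_, ?_⟩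
    · refine ContinuousAt.comp (g := Γ) ?_ hline.continuousAt
      rw [zero_smul]
      exact hΓc.continuousAt (φ.open_target.mem_nhds htgt0)
    · filter_upwards [hline0.eventually (φ.open_target.mem_nhds htgt0)] with t ht
      exact hΓmem _ ht (by simp [hv₀, Pi.single_eq_of_ne hcij])
    · exact HasFDerivAt.comp_hasDerivAt (0 : ℝ) (l := φ.symm)
        (by rw [zero_smul]; exact hφsd.hasFDerivAt) hline
    · rw [hside, hℓ, ContinuousLinearMap.comp_apply, hinv]
      simpa [hv₀] using mul_self_pos.2 hε

end Diagram

theorem hasDerivAt_pos_eventually {f : ℝ → ℝ} {f' : ℝ} (hf : HasDerivAt f f' 0) (hf0 : f 0 = 0)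
    (hpos : 0 < f') : ∀ᶠ t in 𝓝[>] (0 : ℝ), 0 < f t ∧ f (-t) < 0 := by
  have h := hf.tendsto_slope.eventually (lt_mem_nhds hpos)
  rw [eventually_nhdsWithin_iff] at h
  have hneg : Tendsto (fun t : ℝ => -t) (𝓝 0) (𝓝 0) := by
    simpa using (continuous_neg (G := ℝ)).tendsto 0
  filter_upwards [h.filter_mono nhdsWithin_le_nhds, (hneg.eventually h).filter_mono
    nhdsWithin_le_nhds, self_mem_nhdsWithin] with t h1 h2 (ht : 0 < t)
  have h1' := h1 ht.ne'
  have h2' := h2 (neg_ne_zero.2 ht.ne')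
  rw [slope_def_field, hf0, sub_zero, sub_zero] at h1' h2'
  refine ⟨(div_pos_iff_of_pos_right ht).1 h1', ?_⟩
  rcases div_pos_iff.1 h2' with h | h
  · exact absurd h.2 (by linarith)
  · exact h.1

variable {D : Diagram} {x y : R4} {γ : ℝ → R4} {w : R3}

theorem tendsto_neg_nhdsGT : Tendsto (fun t : ℝ => -t) (𝓝[>] 0) (𝓝 0) := by
  simpa using ((continuous_neg (G := ℝ)).tendsto 0).mono_left nhdsWithin_le_nhds

theorem eventually_and_neg {v : ℝ → Prop} (hv : ∀ᶠ t in 𝓝 (0 : ℝ), v t) :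
    ∀ᶠ t in 𝓝[>] (0 : ℝ), v t ∧ v (-t) :=
  (hv.filter_mono nhdsWithin_le_nhds).and (tendsto_neg_nhdsGT.eventually hv)

namespace Diagram

namespace Crosses

theorem eventually_sign (h : D.Crosses x y γ w) {G : R3 → ℝ} {G' : R3 →L[ℝ] ℝ} (hG0 : G x.1 = 0)
    (hG : HasFDerivAt G G' x.1) (hG' : 0 < G' w) :
    ∀ᶠ t in 𝓝[>] (0 : ℝ), 0 < G (γ t).1 ∧ G (γ (-t)).1 < 0 := by
  refine hasDerivAt_pos_eventually (f := fun t => G (γ t).1) (f' := G' w) ?_ ?_ hG'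
  · exact HasFDerivAt.comp_hasDerivAt (0 : ℝ) (l := G)
      (by rw [h.zero, h.fst_eq]; exact hG) h.deriv
  · rw [h.zero, h.fst_eq, hG0]

theorem mem_cutSurface (h : D.Crosses x y γ w) : x ∈ D.cutSurface := by
  obtain ⟨⟨G, G', hG⟩, -⟩ := exists_isSideFunction h.fibre h.lt
  exact hG.mem_cutSurface

end Crosses

end Diagram

/-- Along every curve crossing below the surface, the colors satisfy the coloring condition. -/
theorem RackColoring.eventually_crosses {R : Type*} [Rack R] (c : RackColoring R D)
    (h : D.Crosses x y γ w) (hx : x ∈ D.cutSurface) :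
    ∀ᶠ t in 𝓝[>] (0 : ℝ), ∃ (h₁ : γ (-t) ∈ D.cutSurface) (h₂ : γ t ∈ D.cutSurface),
      c.1 (D.sheet _ h₂) = Shelf.act (c.1 (D.sheet x hx)) (c.1 (D.sheet _ h₁)) := by
  obtain ⟨⟨G, G', hG⟩, -⟩ := Diagram.exists_isSideFunction h.fibre h.lt
  obtain ⟨W, hW, -, -, hP, hN, hPc, hNc⟩ := hG.basis univ univ_mem
  have hev : ∀ᶠ t in 𝓝[>] (0 : ℝ), γ t ∈ {p | p ∈ W ∧ p ∈ D.carrier ∧ 0 < G p.1} ∧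
      γ (-t) ∈ {p | p ∈ W ∧ p ∈ D.carrier ∧ G p.1 < 0} := by
    filter_upwards [h.eventually_sign hG.zero hG.hasFDerivAt ((hG.side w).1 h.side),
      eventually_and_neg (h.mem.and (h.cont.eventually (h.zero.symm ▸ hW)))]
      with t h1 h2 using ⟨⟨h2.1.2, h2.1.1, h1.1⟩, h2.2.2, h2.2.1, h1.2⟩
  filter_upwards [hev] with t ht
  refine ⟨hN ht.2, hP ht.1, c.2 _ _ _ (Diagram.adjacent_iff.2
    ⟨x, y, γ, w, h, Diagram.mem_sheet hx, ?_⟩)⟩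
  -- Adjacency asks for fixed sheets at all small times `s`; both sides of the double curve are
  -- connected, so the sheets found at time `t` serve.
  filter_upwards [hev] with s hs
  rw [Diagram.sheet_eq_of_isPreconnected hNc hN ht.2 hs.2,
    Diagram.sheet_eq_of_isPreconnected hPc hP ht.1 hs.1]
  exact ⟨Diagram.mem_sheet _, Diagram.mem_sheet _⟩

end

/-! ### Ambient isotopy -/

/-- The relation between diagrams underlying `AmbientIsotopic`, with the final map of the isotopy
and its inverse. -/
structure Carries (D D' : Diagram) (Φ Ψ : R3 → R3) (e : D.carrier ≃ₜ D'.carrier) : Prop where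
  left : Function.LeftInverse Ψ Φ
  right : Function.RightInverse Ψ Φ
  diff : Differentiable ℝ Φ
  diff' : Differentiable ℝ Ψ
  fst : ∀ p, (e p).1.1 = Φ p.1.1
  height : ∀ p p' : D.carrier, p.1.1 = p'.1.1 → (p.1.2 < p'.1.2 ↔ (e p).1.2 < (e p').1.2)
  side : ∀ (p : D.carrier) (w : R3), D.PositiveSide p w ↔ D'.PositiveSide (e p) (fderiv ℝ Φ p.1.1 w)

namespace Carries

variable {D D' : Diagram} {Φ Ψ : R3 → R3} {e : D.carrier ≃ₜ D'.carrier}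

theorem symm (h : Carries D D' Φ Ψ e) : Carries D' D Ψ Φ e.symm where
  left := h.right
  right := h.left
  diff := h.diff'
  diff' := h.diff
  fst p := by
    have := h.fst (e.symm p)
    rw [e.apply_symm_apply] at this
    rw [this, h.left]
  height p p' hp := by
    have h1 := h.fst (e.symm p)
    have h2 := h.fst (e.symm p')
    have := h.height (e.symm p) (e.symm p') (by
      rw [e.apply_symm_apply] at h1 h2
      exact h.left.injective (by rw [← h1, ← h2, hp]))
    simpa using this.symm
  side p w := by
    have h1 := h.fst (e.symm p)
    rw [e.apply_symm_apply] at h1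
    have hc : HasFDerivAt (Φ ∘ Ψ) ((fderiv ℝ Φ (e.symm p).1.1).comp (fderiv ℝ Ψ p.1.1)) p.1.1 :=
      HasFDerivAt.comp _ (by rw [h1, h.left]; exact (h.diff _).hasFDerivAt) (h.diff' _).hasFDerivAt
    have hid : Φ ∘ Ψ = id := h.right.comp_eq_id
    rw [hid] at hc
    have hw : fderiv ℝ Φ (e.symm p).1.1 (fderiv ℝ Ψ p.1.1 w) = w :=
      congrArg (fun T : R3 →L[ℝ] R3 => T w) (hc.unique (hasFDerivAt_id _))
    rw [h.side, hw, e.apply_symm_apply]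

theorem mem_lower_iff (h : Carries D D' Φ Ψ e) (p : D.carrier) :
    (e p).1 ∈ D'.lower ↔ p.1 ∈ D.lower := by
  suffices H : ∀ {D D' : Diagram} {Φ Ψ : R3 → R3} {e : D.carrier ≃ₜ D'.carrier},
      Carries D D' Φ Ψ e → ∀ p : D.carrier, p.1 ∈ D.lower → (e p).1 ∈ D'.lower from
    ⟨fun hp => by simpa using H h.symm (e p) hp, H h p⟩
  rintro D D' Φ Ψ e h p ⟨-, p', hp', h1, h2⟩
  exact ⟨(e p).2, (e ⟨p', hp'⟩).1, (e ⟨p', hp'⟩).2, by rw [h.fst, h.fst, h1],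
    (h.height p ⟨p', hp'⟩ h1.symm).1 h2⟩

/-- The homeomorphism `e` lives on the surfaces only, so the closure of the lower points has to be
taken inside the surface before it can be transported. -/
theorem mem_cutSurface_iff (h : Carries D D' Φ Ψ e) (p : D.carrier) :
    (e p).1 ∈ D'.cutSurface ↔ p.1 ∈ D.cutSurface := by
  have hpre : ∀ D : Diagram, ∀ p : D.carrier, p.1 ∈ D.cutSurface ↔
      p ∉ closure ((↑) ⁻¹' D.lower : Set D.carrier) := by
    intro D p
    rw [Topology.IsInducing.subtypeVal.closure_eq_preimage_closure_image,
      Subtype.image_preimage_coe, inter_eq_right.2 fun q hq => hq.1]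
    simp [Diagram.cutSurface]
  rw [hpre, hpre, not_iff_not]
  have : ((↑) ⁻¹' D.lower : Set D.carrier) = e ⁻¹' ((↑) ⁻¹' D'.lower) := by
    ext q; exact (h.mem_lower_iff q).symm
  rw [this, ← e.preimage_closure]
  rfl

/-- The map carries crossing curves to crossing curves. -/
theorem crosses (h : Carries D D' Φ Ψ e) {x y : R4} {γ : ℝ → R4} {w : R3}
    (hc : D.Crosses x y γ w) (γ' : ℝ → R4)
    (hγ' : ∀ t (ht : γ t ∈ D.carrier), γ' t = (e ⟨γ t, ht⟩).1) :
    D'.Crosses (e ⟨x, hc.mem_upper⟩).1 (e ⟨y, hc.mem_lower⟩).1 γ' (fderiv ℝ Φ x.1 w) := by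
  have h0 : γ 0 ∈ D.carrier := hc.zero ▸ hc.mem_lower
  have hev : ∀ᶠ t in 𝓝 (0 : ℝ), ∃ ht : γ t ∈ D.carrier, γ' t = (e ⟨γ t, ht⟩).1 :=
    hc.mem.mono fun t ht => ⟨ht, hγ' t ht⟩
  refine ⟨?_, (h.height ⟨y, _⟩ ⟨x, _⟩ hc.fst_eq).1 hc.lt, ?_, ?_, ?_, ?_, (h.side ⟨x, _⟩ w).1 hc.side⟩
  · ext p
    constructor
    · rintro ⟨hp, hpx⟩
      have h1 : (e.symm ⟨p, hp⟩).1.1 = x.1 := by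
        have := h.symm.fst ⟨p, hp⟩
        rw [this, hpx, h.fst, h.left]
      rcases hc.eq_or_eq (e.symm ⟨p, hp⟩).2 h1 with h2 | h2
      · left
        have : e.symm ⟨p, hp⟩ = ⟨x, hc.mem_upper⟩ := Subtype.ext h2
        rw [← this, e.apply_symm_apply]
      · right
        have : e.symm ⟨p, hp⟩ = ⟨y, hc.mem_lower⟩ := Subtype.ext h2
        rw [← this, e.apply_symm_apply]
        rfl
    · rintro (rfl | rfl)
      · exact ⟨Subtype.coe_prop _, rfl⟩
      · exact ⟨Subtype.coe_prop _, by rw [h.fst, h.fst]; exact congrArg Φ hc.fst_eq⟩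
  · rw [hγ' 0 h0]; congr 2; exact Subtype.ext hc.zero
  · rw [ContinuousAt, hγ' 0 h0, tendsto_nhds]
    intro s hs hs0
    have h1 : (fun p : D.carrier => (e p).1) ⁻¹' s ∈ 𝓝 (⟨γ 0, h0⟩ : D.carrier) :=
      (hs.preimage (continuous_subtype_val.comp e.continuous)).mem_nhds hs0
    obtain ⟨O, hO, hsub⟩ := mem_nhds_induced _ _ _ |>.1 h1
    filter_upwards [hc.cont.eventually hO, hev] with t ht hte
    obtain ⟨h2, h3⟩ := hte
    change γ' t ∈ s
    rw [h3]
    exact hsub (show (⟨γ t, h2⟩ : D.carrier) ∈ Subtype.val ⁻¹' O from ht)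
  · filter_upwards [hev] with t ht
    obtain ⟨h2, h3⟩ := ht
    exact h3 ▸ Subtype.coe_prop _
  · have h1 : HasDerivAt (fun t => Φ (γ t).1) (fderiv ℝ Φ x.1 w) 0 :=
      HasFDerivAt.comp_hasDerivAt (0 : ℝ) (l := Φ)
        (by rw [hc.zero, hc.fst_eq]; exact (h.diff _).hasFDerivAt) hc.deriv
    refine h1.congr_of_eventuallyEq ?_
    filter_upwards [hev] with t ht
    obtain ⟨h2, h3⟩ := ht
    rw [h3, h.fst]

variable {R : Type*} [Rack R]

theorem exists_coloring (h : Carries D D' Φ Ψ e) (c : RackColoring R D) :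
    ∃ c' : RackColoring R D', ∀ (p : D.carrier) (hp : p.1 ∈ D.cutSurface)
      (hp' : (e p).1 ∈ D'.cutSurface), c'.1 (D'.sheet _ hp') = c.1 (D.sheet _ hp) := by
  have hsymm : ∀ q : D'.cutSurface, (e.symm ⟨q.1, q.2.1⟩).1 ∈ D.cutSurface := fun q =>
    (h.symm.mem_cutSurface_iff ⟨q.1, q.2.1⟩).2 q.2
  have hcont : Continuous fun q : D'.cutSurface => (⟨_, hsymm q⟩ : D.cutSurface) := by
    refine Continuous.subtype_mk (continuous_subtype_val.comp (e.symm.continuous.comp ?_)) _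
    exact Continuous.subtype_mk continuous_subtype_val _
  obtain ⟨c', hc'⟩ := RackColoring.exists_of_isLocallyConstant
    (fun q : D'.cutSurface => c.1 (D.sheet _ (hsymm q)))
    (c.isLocallyConstant.comp_continuous hcont) (by
      intro x y γ w hcr hx
      classical
      -- Off the surface `e.symm` is undefined; the dummy value `0` is harmless because `γ` stays on
      -- the surface for small times.
      set γ' : ℝ → R4 := fun t => if ht : γ t ∈ D'.carrier then (e.symm ⟨γ t, ht⟩).1 else 0 with hγ'
      have hγ'' : ∀ t (ht : γ t ∈ D'.carrier), γ' t = (e.symm ⟨γ t, ht⟩).1 := fun t ht => dif_pos ht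
      have hcr' := h.symm.crosses hcr γ' hγ''
      filter_upwards [c.eventually_crosses hcr' hcr'.mem_cutSurface] with t ht h1 h2
      obtain ⟨h3, h4, h5⟩ := ht
      simp only [hγ'' _ h1.1, hγ'' _ h2.1] at h5
      exact h5)
  refine ⟨c', fun p hp hp' => ?_⟩
  rw [hc']
  have : ∀ q, q = p.1 → ∀ hq, c.1 (D.sheet q hq) = c.1 (D.sheet _ hp) := by
    rintro _ rfl _; rfl
  exact this _ (by simp) _

theorem nonempty_equiv (h : Carries D D' Φ Ψ e) :
    Nonempty (RackColoring R D ≃ RackColoring R D') := by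
  choose F hF using h.exists_coloring (R := R)
  choose F' hF' using h.symm.exists_coloring (R := R)
  refine ⟨⟨F, F', fun c => RackColoring.ext_sheet fun p hp => ?_,
    fun c => RackColoring.ext_sheet fun p hp => ?_⟩⟩
  · have h1 := (h.mem_cutSurface_iff ⟨p, hp.1⟩).2 hp
    have h2 := hF' (F c) (e ⟨p, hp.1⟩) h1
    rw [e.symm_apply_apply] at h2
    rw [h2 hp]
    exact hF c ⟨p, hp.1⟩ hp h1
  · have h1 := (h.symm.mem_cutSurface_iff ⟨p, hp.1⟩).2 hp
    have h2 := hF (F' c) (e.symm ⟨p, hp.1⟩) h1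
    rw [e.apply_symm_apply] at h2
    rw [h2 hp]
    exact hF' c ⟨p, hp.1⟩ hp h1

end Carries

theorem AmbientIsotopic.nonempty_equiv {D D' : Diagram} (h : AmbientIsotopic D D')
    {R : Type*} [Rack R] : Nonempty (RackColoring R D ≃ RackColoring R D') := by
  obtain ⟨Φ, Ψ, hΦ, hΨ, hinv, -, e, h1, h2, h3⟩ := h
  have hd : ∀ {F : ℝ → R3 → R3}, ContDiff ℝ ∞ (Function.uncurry F) → Differentiable ℝ (F 1) :=
    fun {F} hF => (hF.differentiable (by simp)).comp
      ((differentiable_const (1 : ℝ)).prodMk differentiable_id)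
  exact Carries.nonempty_equiv (e := e) ⟨(hinv 1).1, (hinv 1).2, hd hΦ, hd hΨ, h1, h2, h3⟩

/-! ### Rack actions of a stack of disks -/

section Rack

variable {R : Type*} [Rack R] {n : ℕ}

theorem partialProd_congr {M : Type*} [Monoid M] {f f' : Fin n → M} (k : Fin (n + 1))
    (h : ∀ j : Fin n, j.castSucc < k → f j = f' j) : Fin.partialProd f k = Fin.partialProd f' k := by
  induction k using Fin.induction with
  | zero => simp
  | succ k ih =>
    rw [Fin.partialProd_succ, Fin.partialProd_succ, h k Fin.castSucc_lt_succ,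
      ih fun j hj => h j (hj.trans Fin.castSucc_lt_succ)]

/-- With `A` the product before position `j`, inserting a factor `x` turns `A * B` into `A * x * B =
(A * x * A⁻¹) * (A * B)`. -/
theorem partialProd_eq_conj_mul {G : Type*} [Group G] {f f' : Fin n → G} {j : Fin n}
    (hj : f j = 1) (k : Fin (n + 1)) (h : ∀ l : Fin n, l.castSucc < k → l ≠ j → f' l = f l)
    (hjk : j.castSucc < k) : Fin.partialProd f' k =
      Fin.partialProd f j.castSucc * f' j * (Fin.partialProd f j.castSucc)⁻¹ *
        Fin.partialProd f k := by
  induction k using Fin.induction with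
  | zero => exact absurd hjk (Fin.not_lt_zero _)
  | succ k ih =>
    rw [Fin.partialProd_succ, Fin.partialProd_succ]
    rcases (Fin.castSucc_lt_succ_iff.1 hjk).eq_or_lt with rfl | hlt
    · rw [hj, mul_one, inv_mul_cancel_right]
      congr 1
      exact partialProd_congr _ fun l hl =>
        h l (hl.trans Fin.castSucc_lt_succ) (Fin.castSucc_lt_castSucc_iff.1 hl).ne
    · rw [ih (fun l hl => h l (hl.trans Fin.castSucc_lt_succ))
        (Fin.castSucc_lt_castSucc_iff.2 hlt), h k Fin.castSucc_lt_succ hlt.ne', mul_assoc,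
        mul_assoc, mul_assoc]

open Classical in
/-- The action of `a` if `P` holds, and the identity otherwise. -/
noncomputable def actIf (a : R) (P : Prop) : Equiv.Perm R :=
  if P then Rack.act' a else 1

theorem actIf_of {a : R} {P : Prop} (h : P) : actIf a P = Rack.act' a := if_pos h

theorem actIf_of_not {a : R} {P : Prop} (h : ¬P) : actIf a P = 1 := if_neg h

/-- For disks `0, 1, …` ordered from the top, with base colors `a`, the change of color of the
`i`-th disk when it passes to the positive side of those disks `j < i` for which `P j` holds. -/
noncomputable def passage (a : Fin n → R) (P : Fin n → Prop) (i : Fin n) : Equiv.Perm R :=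
  Fin.partialProd (fun j => actIf (a j) (P j)) i.castSucc

theorem passage_congr {a a' : Fin n → R} {P P' : Fin n → Prop} {i : Fin n}
    (ha : ∀ j < i, a j = a' j) (hP : ∀ j < i, (P j ↔ P' j)) : passage a P i = passage a' P' i := by
  refine partialProd_congr _ fun j hj => ?_
  have hj' := Fin.castSucc_lt_castSucc_iff.1 hj
  simp only [ha j hj', propext (hP j hj')]

/-- Self-distributivity says that every action is a rack homomorphism, and homomorphisms compose. -/
theorem passage_act (a : Fin n → R) (P : Fin n → Prop) (i : Fin n) (x y : R) :
    passage a P i (Shelf.act x y) = Shelf.act (passage a P i x) (passage a P i y) := by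
  unfold passage
  generalize i.castSucc = k
  induction k using Fin.induction generalizing x y with
  | zero => simp
  | succ k ih =>
    rw [Fin.partialProd_succ]
    simp only [Equiv.Perm.mul_apply]
    by_cases h : P k
    · rw [actIf_of h, Rack.act'_apply, Rack.act'_apply, Rack.act'_apply, ← ih,
        Shelf.self_distrib]
    · rw [actIf_of_not h]
      exact ih x y

/-- Crossing the `j`-th disk in its normal direction acts by the color of the `j`-th disk. -/
theorem passage_eq_act {a : Fin n → R} {P P' : Fin n → Prop} {i j : Fin n} (hji : j < i)
    (h : ∀ l < i, l ≠ j → (P' l ↔ P l)) (hj : ¬P j) (hj' : P' j) (z : R) :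
    passage a P' i z = Shelf.act (passage a P j (a j)) (passage a P i z) := by
  -- The conjugating factor involves only the disks above the `j`-th one; by `passage_act` it turns
  -- the action of `a j` into the action of the actual color of the `j`-th disk.
  have h2 : passage a P' i = passage a P j * Rack.act' (a j) * (passage a P j)⁻¹ * passage a P i := by
    have := partialProd_eq_conj_mul (f := fun j => actIf (a j) (P j))
      (f' := fun j => actIf (a j) (P' j)) (actIf_of_not hj) i.castSucc
      (fun l hl hlj => by simp only [propext (h l (Fin.castSucc_lt_castSucc_iff.1 hl) hlj)])
      (Fin.castSucc_lt_castSucc_iff.2 hji)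
    simp only [actIf_of hj'] at this
    exact this
  rw [h2]
  simp only [Equiv.Perm.mul_apply, Rack.act'_apply, passage_act]
  simp

end Rack

/-! ### Connectedness and locally constant functions -/

section Topology

theorem IsPreconnected.pos_of_ne_zero {X : Type*} [TopologicalSpace X] {s : Set X}
    (hs : IsPreconnected s) {f : X → ℝ} (hf : ContinuousOn f s) (h0 : ∀ p ∈ s, f p ≠ 0) {p q : X}
    (hp : p ∈ s) (hq : q ∈ s) (hfp : 0 < f p) : 0 < f q := by
  by_contra! h
  obtain ⟨z, hz, hz0⟩ := hs.intermediate_value hq hp hf ⟨h, hfp.le⟩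
  exact h0 z hz hz0

/-- A function on a dense part `T` of a preconnected set `S` that is constant on `T` near every
point of `S` is constant. -/
theorem IsConnected.exists_eq_of_eventually_eq {X α : Type*} [TopologicalSpace X] {S T : Set X}
    (hS : IsConnected S) (hTS : T ⊆ S) (F : T → α) (hd : S ⊆ closure T)
    (hF : ∀ p ∈ S, ∃ r, ∀ᶠ q in 𝓝 p, ∀ hq : q ∈ T, F ⟨q, hq⟩ = r) : ∃ r, ∀ q, F q = r := by
  choose r hr using fun p : S => hF p p.2
  have hloc : IsLocallyConstant r := by
    rw [IsLocallyConstant.iff_eventually_eq]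
    intro p
    have := continuousAt_subtype_val.eventually (hr p).eventually_nhds
    filter_upwards [this] with q hq
    obtain ⟨z, ⟨h1, h2⟩, hz⟩ := (mem_closure_iff_frequently.1 (hd q.2)).and_eventually
      (hq.and (hr q)) |>.exists.imp fun _ h => h.symm
    rw [← h1 hz, ← h2 hz]
  obtain ⟨p₀, hp₀⟩ := hS.nonempty
  have := isPreconnected_iff_preconnectedSpace.1 hS.isPreconnected
  refine ⟨r ⟨p₀, hp₀⟩, fun q => ?_⟩
  rw [← hloc.apply_eq_of_preconnectedSpace ⟨q.1, hTS q.2⟩ ⟨p₀, hp₀⟩]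
  exact (hr ⟨q.1, hTS q.2⟩).self_of_nhds q.2

end Topology

/-! ### Base colors of a stack of disks -/

/-- The point `p` lies on the `i`-th disk over the chart `φ`. -/
def OnDisk (φ : OpenPartialHomeomorph R3 R3) {n : ℕ} (g H : Fin n → R3 → ℝ) (i : Fin n)
    (p : R4) : Prop :=
  p.1 ∈ φ.source ∧ g i (φ p.1) = 0 ∧ p.2 = H i p.1

/-- Over the chart `φ`, the diagram consists of disks `{g i = 0}`, ordered from the top, with the
normal directions in which `g i` increases, and with countably many multiple points that are not
double points. -/
structure IsDiskModel (D : Diagram) (φ : OpenPartialHomeomorph R3 R3) {n : ℕ}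
    (g H : Fin n → R3 → ℝ) : Prop where
  graphs : IsGraphs D.carrier φ g H
  anti : ∀ q ∈ φ.source, ∀ i j, i < j → H j q < H i q
  normals : ∀ p ∈ D.carrier, ∀ i, OnDisk φ g H i p →
    ∀ w, D.PositiveSide p w ↔ 0 < fderiv ℝ (g i ∘ φ) p.1 w
  cont : ∀ i, Continuous (g i)
  connected : ∀ i, ∀ C : Set R3, C.Countable → IsConnected ({v | v ∈ φ.target ∧ g i v = 0} \ C)
  countable : ∀ i, {v | v ∈ φ.target ∧ g i v = 0 ∧
    ∃ j k, j ≠ i ∧ k ≠ i ∧ j ≠ k ∧ g j v = 0 ∧ g k v = 0}.Countable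

/-- The color at a point with coordinates `v` of the `i`-th disk, for the base colors `a`. -/
noncomputable def diskColor {R : Type*} [Rack R] {n : ℕ} (g : Fin n → R3 → ℝ) (a : Fin n → R)
    (i : Fin n) (v : R3) : R :=
  passage a (fun j => 0 < g j v) i (a i)

namespace IsDiskModel

variable {D : Diagram} {φ : OpenPartialHomeomorph R3 R3} {n : ℕ} {g H : Fin n → R3 → ℝ}

theorem exists_onDisk (h : IsDiskModel D φ g H) {p : R4} (hp : p ∈ D.carrier)
    (hs : p.1 ∈ φ.source) : ∃ i, OnDisk φ g H i p := by
  obtain ⟨i, h1, h2⟩ := (h.graphs.2.2 p hs).1 hp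
  exact ⟨i, hs, h1, h2⟩

theorem mem_carrier (h : IsDiskModel D φ g H) {p : R4} {i : Fin n} (hp : OnDisk φ g H i p) :
    p ∈ D.carrier :=
  (h.graphs.2.2 p hp.1).2 ⟨i, hp.2⟩

theorem eq_of_onDisk (h : IsDiskModel D φ g H) {p : R4} {i j : Fin n} (hi : OnDisk φ g H i p)
    (hj : OnDisk φ g H j p) : i = j := by
  by_contra hij
  exact h.graphs.2.1 i j hij _ hi.1 (hi.2.2.symm.trans hj.2.2)

theorem lt_of_height_lt (h : IsDiskModel D φ g H) {q : R3} (hq : q ∈ φ.source) {i j : Fin n}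
    (hij : H i q < H j q) : j < i := by
  by_contra! hle
  rcases hle.eq_or_lt with rfl | hlt
  · exact hij.false
  · exact (h.anti q hq i j hlt).not_gt hij

theorem continuousAt_height (h : IsDiskModel D φ g H) (i : Fin n) {p : R4} (hp : p.1 ∈ φ.source) :
    ContinuousAt (fun q : R4 => H i q.1) p :=
  ContinuousAt.comp (f := fun q : R4 => q.1)
    (((h.graphs.1 i).continuousOn).continuousAt (φ.open_source.mem_nhds hp)) continuousAt_fst

theorem continuousAt_equation (h : IsDiskModel D φ g H) (i : Fin n) {p : R4}
    (hp : p.1 ∈ φ.source) : ContinuousAt (fun q : R4 => g i (φ q.1)) p :=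
  (h.cont i).continuousAt.comp
    (ContinuousAt.comp (f := fun q : R4 => q.1) (φ.continuousAt hp) continuousAt_fst)

/-- Distinct disks have distinct continuous heights, so the other disks stay away from `p` in `ℝ⁴`.
-/
theorem eventually_onDisk (h : IsDiskModel D φ g H) {p : R4} {i : Fin n}
    (hp : OnDisk φ g H i p) : ∀ᶠ q in 𝓝 p, q ∈ D.carrier → OnDisk φ g H i q := by
  have h1 : ∀ᶠ q : R4 in 𝓝 p, q.1 ∈ φ.source :=
    continuousAt_fst.eventually (φ.open_source.mem_nhds hp.1)
  have h2 : ∀ᶠ q : R4 in 𝓝 p, ∀ k, k ≠ i → q.2 ≠ H k q.1 := by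
    rw [eventually_all]
    intro k
    by_cases hk : k = i
    · simp [hk]
    have hne : p.2 ≠ H k p.1 := by rw [hp.2.2]; exact h.graphs.2.1 i k (Ne.symm hk) _ hp.1
    filter_upwards [((continuousAt_snd (p := p)).ne_iff_eventually_ne
      (h.continuousAt_height k hp.1)).1 hne] with q hq _ using hq
  filter_upwards [h1, h2] with q h1 h2 hq
  obtain ⟨k, hk⟩ := h.exists_onDisk hq h1
  by_cases hki : k = i
  · exact hki ▸ hk
  · exact absurd hk.2.2 (h2 k hki)

theorem eventually_sign (h : IsDiskModel D φ g H) {p : R4} (hp : p.1 ∈ φ.source) :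
    ∀ᶠ q : R4 in 𝓝 p, ∀ k, g k (φ p.1) ≠ 0 →
      g k (φ q.1) ≠ 0 ∧ (0 < g k (φ q.1) ↔ 0 < g k (φ p.1)) := by
  rw [eventually_all]
  intro k
  rcases lt_trichotomy (g k (φ p.1)) 0 with h0 | h0 | h0
  · filter_upwards [(h.continuousAt_equation k hp).eventually_lt_const h0] with q hq _
    exact ⟨hq.ne, iff_of_false hq.not_gt h0.not_gt⟩
  · simp [h0]
  · filter_upwards [(h.continuousAt_equation k hp).eventually_const_lt h0] with q hq _
    exact ⟨hq.ne', iff_of_true hq h0⟩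

theorem ne_zero_of_mem_cutSurface (h : IsDiskModel D φ g H) {p : R4} {i j : Fin n}
    (hp : OnDisk φ g H i p) (hc : p ∈ D.cutSurface) (hj : j < i) : g j (φ p.1) ≠ 0 := by
  intro h0
  refine Diagram.notMem_lower_of_mem_cutSurface hc ⟨hc.1, (p.1, H j p.1),
    h.mem_carrier (i := j) ⟨hp.1, h0, rfl⟩, rfl, ?_⟩
  rw [hp.2.2]
  exact h.anti _ hp.1 _ _ hj

/-- Equations that do not vanish at `p` do not vanish nearby, so no point of the disk near `p` lies
below another point. -/
theorem mem_cutSurface (h : IsDiskModel D φ g H) {p : R4} {i : Fin n}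
    (hp : OnDisk φ g H i p) (h0 : ∀ j < i, g j (φ p.1) ≠ 0) : p ∈ D.cutSurface := by
  refine ⟨h.mem_carrier hp, fun hcl => ?_⟩
  obtain ⟨q, ⟨h1, h2⟩, hq, q', hq', h3, h4⟩ := (mem_closure_iff_frequently.1 hcl).and_eventually
    ((h.eventually_onDisk hp).and (h.eventually_sign hp.1)) |>.exists.imp fun _ h => h.symm
  have hqi := h1 hq
  obtain ⟨k, hk⟩ := h.exists_onDisk hq' (h3 ▸ hqi.1)
  have hki : k < i := by
    apply h.lt_of_height_lt hqi.1
    rw [← hqi.2.2, ← h3, ← hk.2.2]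
    exact h4
  exact (h2 k (h0 k hki)).1 (h3 ▸ hk.2.1)

/-- A curve crossing below the `j`-th disk stays on one disk and passes from the negative to the
positive side of the `j`-th disk. -/
theorem eventually_crosses (h : IsDiskModel D φ g H) {x y : R4} {γ : ℝ → R4} {w : R3}
    (hc : D.Crosses x y γ w) {i j : Fin n} (hx : OnDisk φ g H j x) (hy : OnDisk φ g H i y) :
    j < i ∧ ∀ᶠ t in 𝓝[>] (0 : ℝ), (OnDisk φ g H i (γ t) ∧ OnDisk φ g H i (γ (-t))) ∧
      (0 < g j (φ (γ t).1) ∧ g j (φ (γ (-t)).1) < 0) ∧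
      ∀ k, k ≠ i → k ≠ j → (0 < g k (φ (γ t).1) ↔ 0 < g k (φ x.1)) ∧
        (0 < g k (φ (γ (-t)).1) ↔ 0 < g k (φ x.1)) := by
  have hyx := hc.fst_eq
  have hji : j < i := h.lt_of_height_lt hx.1 (by
    rw [← hx.2.2, ← hyx, ← hy.2.2]; exact hc.lt)
  -- A third disk would add a third point to the fibre `{x, y}`.
  have hother : ∀ k, k ≠ i → k ≠ j → g k (φ x.1) ≠ 0 := by
    intro k hki hkj h0
    have hk : OnDisk φ g H k (x.1, H k x.1) := ⟨hx.1, h0, rfl⟩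
    rcases hc.eq_or_eq (h.mem_carrier hk) rfl with h1 | h1
    · exact hkj (h.eq_of_onDisk (h1 ▸ hk) hx)
    · exact hki (h.eq_of_onDisk (h1 ▸ hk) hy)
  refine ⟨hji, ?_⟩
  have hpos : 0 < fderiv ℝ (g j ∘ φ) x.1 w := (h.normals x hc.mem_upper j hx w).1 hc.side
  -- Without differentiability `fderiv` has the default value `0`, contradicting `hpos`.
  have hdiff : DifferentiableAt ℝ (g j ∘ φ) x.1 := by
    by_contra hnd
    rw [fderiv_zero_of_not_differentiableAt hnd] at hpos
    simp at hpos
  have hev := hc.cont.eventually (p := fun q => (q ∈ D.carrier → OnDisk φ g H i q) ∧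
    ∀ k, g k (φ x.1) ≠ 0 → g k (φ q.1) ≠ 0 ∧ (0 < g k (φ q.1) ↔ 0 < g k (φ x.1))) (by
      rw [hc.zero, ← hyx]
      exact (h.eventually_onDisk hy).and (h.eventually_sign hy.1))
  filter_upwards [eventually_and_neg (hc.mem.and hev),
    hc.eventually_sign (G := g j ∘ φ) hx.2.1 hdiff.hasFDerivAt hpos]
    with t ⟨⟨m1, d1, s1⟩, m2, d2, s2⟩ hp
  exact ⟨⟨d1 m1, d2 m2⟩, hp, fun k hki hkj =>
    ⟨(s1 k (hother k hki hkj)).2, (s2 k (hother k hki hkj)).2⟩⟩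

/-- The colors given by base colors satisfy the coloring condition. -/
theorem eventually_diskColor_eq (h : IsDiskModel D φ g H) {R : Type*} [Rack R] {x y : R4}
    {γ : ℝ → R4} {w : R3} (hc : D.Crosses x y γ w) {i j : Fin n} (hx : OnDisk φ g H j x)
    (hy : OnDisk φ g H i y) (a : Fin n → R) :
    ∀ᶠ t in 𝓝[>] (0 : ℝ), (OnDisk φ g H i (γ t) ∧ OnDisk φ g H i (γ (-t))) ∧
      diskColor g a i (φ (γ t).1) =
        Shelf.act (diskColor g a j (φ x.1)) (diskColor g a i (φ (γ (-t)).1)) := by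
  obtain ⟨hji, hev⟩ := h.eventually_crosses hc hx hy
  filter_upwards [hev] with t ⟨hd, ⟨p1, p2⟩, hs⟩
  refine ⟨hd, ?_⟩
  unfold diskColor
  rw [passage_eq_act (P := fun l => 0 < g l (φ (γ (-t)).1)) hji
    (fun l hl hlj => (hs l hl.ne hlj).1.trans (hs l hl.ne hlj).2.symm) p2.not_gt p1]
  congr 2
  exact passage_congr (fun _ _ => rfl) fun l hl => (hs l (hl.trans hji).ne hl.ne).2

end IsDiskModel

namespace IsDiskModel

variable {D : Diagram} {φ : OpenPartialHomeomorph R3 R3} {n : ℕ} {g H : Fin n → R3 → ℝ}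

/-- Near a double point where it passes below the `j`-th disk only, the `i`-th disk is cut into two
sides `P` and `N`, the positive and the negative side of the `j`-th disk. -/
theorem exists_sides (h : IsDiskModel D φ g H) {y : R4} {i j : Fin n} (hy : OnDisk φ g H i y)
    (hji : j < i) (hj : g j (φ y.1) = 0) (hother : ∀ k, k ≠ i → k ≠ j → g k (φ y.1) ≠ 0) :
    ∃ γ w P N, D.Crosses (y.1, H j y.1) y γ w ∧ OnDisk φ g H j (y.1, H j y.1) ∧
      IsPreconnected P ∧ IsPreconnected N ∧ P ⊆ D.cutSurface ∧ N ⊆ D.cutSurface ∧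
      (∀ q ∈ P, 0 < g j (φ q.1)) ∧ (∀ q ∈ N, ¬0 < g j (φ q.1)) ∧
      (∀ q ∈ P ∪ N, OnDisk φ g H i q ∧
        ∀ k, k ≠ i → k ≠ j → (0 < g k (φ q.1) ↔ 0 < g k (φ y.1))) ∧
      (∀ᶠ q in 𝓝 y, q ∈ D.cutSurface → q ∈ P ∪ N) ∧
      ∀ᶠ t in 𝓝[>] (0 : ℝ), γ t ∈ P ∧ γ (-t) ∈ N := by
  set x : R4 := (y.1, H j y.1) with hxdef
  have hx : OnDisk φ g H j x := ⟨hy.1, hj, rfl⟩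
  have hfib : {p | p ∈ D.carrier ∧ p.1 = x.1} = {x, y} := by
    ext p
    constructor
    · rintro ⟨hp, hpx⟩
      obtain ⟨k, hk⟩ := h.exists_onDisk hp (hpx ▸ hy.1)
      have hk2 := hk.2.2
      rw [hpx] at hk2
      by_cases hkj : k = j
      · left; subst hkj; exact Prod.ext hpx hk2
      by_cases hki : k = i
      · right; subst hki; exact Prod.ext hpx (hk2.trans hy.2.2.symm)
      exact absurd (hpx ▸ hk.2.1) (hother k hki hkj)
    · rintro (rfl | rfl)
      · exact ⟨h.mem_carrier hx, rfl⟩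
      · exact ⟨h.mem_carrier hy, rfl⟩
  have hlt : y.2 < x.2 := by rw [hy.2.2]; exact h.anti _ hy.1 _ _ hji
  obtain ⟨⟨G, G', hG⟩, γ, w, hc⟩ := Diagram.exists_isSideFunction hfib hlt
  obtain ⟨W, hW, hWV, hW0, hP, hN, hPc, hNc⟩ := hG.basis
    {q | (q ∈ D.carrier → OnDisk φ g H i q) ∧ ∀ k, g k (φ y.1) ≠ 0 →
      g k (φ q.1) ≠ 0 ∧ (0 < g k (φ q.1) ↔ 0 < g k (φ y.1))}
    ((h.eventually_onDisk hy).and (h.eventually_sign hy.1))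
  set P := {p | p ∈ W ∧ p ∈ D.carrier ∧ 0 < G p.1} with hPdef
  set N := {p | p ∈ W ∧ p ∈ D.carrier ∧ G p.1 < 0} with hNdef
  have hev : ∀ᶠ t in 𝓝[>] (0 : ℝ), γ t ∈ P ∧ γ (-t) ∈ N := by
    filter_upwards [hc.eventually_sign hG.zero hG.hasFDerivAt ((hG.side w).1 hc.side),
      eventually_and_neg (hc.mem.and (hc.cont.eventually (hc.zero.symm ▸ hW)))]
      with t h1 h2 using ⟨⟨h2.1.2, h2.1.1, h1.1⟩, h2.2.2, h2.2.1, h1.2⟩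
  have hPN : ∀ q ∈ P ∪ N, OnDisk φ g H i q ∧
      ∀ k, k ≠ i → k ≠ j → (0 < g k (φ q.1) ↔ 0 < g k (φ y.1)) := by
    intro q hq
    have hq' : q ∈ W ∧ q ∈ D.carrier := hq.elim (fun h => ⟨h.1, h.2.1⟩) fun h => ⟨h.1, h.2.1⟩
    have := hWV hq'.1
    exact ⟨this.1 hq'.2, fun k hki hkj => (this.2 k (hother k hki hkj)).2⟩
  have hne : ∀ q ∈ P ∪ N, g j (φ q.1) ≠ 0 := fun q hq =>
    h.ne_zero_of_mem_cutSurface (hPN q hq).1 (hq.elim (fun h => hP h) fun h => hN h) hji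
  -- The connected sides `P` and `N` come from the generic chart, not from `g j`. Since `g j` has no
  -- zero on them it has a constant sign on each, which is read off from the crossing curve.
  have hcont : ContinuousOn (fun q : R4 => g j (φ q.1)) (P ∪ N) := fun q hq =>
    (h.continuousAt_equation j (hPN q hq).1.1).continuousWithinAt
  obtain ⟨t, ht, -, ⟨hp, hn⟩, -⟩ := (hev.and (h.eventually_crosses hc hx hy).2).exists
  refine ⟨γ, w, P, N, hc, hx, hPc, hNc, hP, hN, fun q hq => ?_, fun q hq hq0 => ?_, hPN, ?_, hev⟩
  · exact IsPreconnected.pos_of_ne_zero hPc (hcont.mono subset_union_left)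
      (fun z hz => hne z (Or.inl hz)) ht.1 hq hp
  · exact hn.not_gt (IsPreconnected.pos_of_ne_zero hNc (hcont.mono subset_union_right)
      (fun z hz => hne z (Or.inr hz)) hq ht.2 hq0)
  · filter_upwards [hW] with q hq hqc
    rcases lt_trichotomy (G q.1) 0 with h0 | h0 | h0
    · exact Or.inr ⟨hq, hqc.1, h0⟩
    · exact absurd (hW0 q hq hqc.1 h0) (Diagram.notMem_lower_of_mem_cutSurface hqc)
    · exact Or.inl ⟨hq, hqc.1, h0⟩

/-- Such a point either lies in the cut surface or is a double point, which is approached along a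
crossing curve. -/
theorem mem_closure_cutSurface (h : IsDiskModel D φ g H) {p : R4} {i : Fin n}
    (hp : OnDisk φ g H i p)
    (hdouble : ∀ j < i, g j (φ p.1) = 0 → ∀ k, k ≠ i → k ≠ j → g k (φ p.1) ≠ 0) :
    p ∈ closure {q | q ∈ D.cutSurface ∧ OnDisk φ g H i q} := by
  by_cases h0 : ∀ j < i, g j (φ p.1) ≠ 0
  · exact subset_closure ⟨h.mem_cutSurface hp h0, hp⟩
  push Not at h0
  obtain ⟨j, hji, hj⟩ := h0
  obtain ⟨γ, w, P, N, hc, -, -, -, hP, -, -, -, hPN, -, hev⟩ :=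
    h.exists_sides hp hji hj (hdouble j hji hj)
  have htend : Tendsto γ (𝓝[>] 0) (𝓝 p) := by
    have := hc.cont.tendsto
    rw [hc.zero] at this
    exact this.mono_left nhdsWithin_le_nhds
  exact mem_closure_of_tendsto htend (hev.mono fun t ht => ⟨hP ht.1, (hPN _ (Or.inl ht.1)).1⟩)

/-- The `i`-th disk without those multiple points where it passes below more than one disk or is
the middle disk. -/
def simplePart (φ : OpenPartialHomeomorph R3 R3) (g H : Fin n → R3 → ℝ) (i : Fin n) : Set R4 :=
  {p | OnDisk φ g H i p ∧ ∀ j < i, g j (φ p.1) = 0 → ∀ k, k ≠ i → k ≠ j → g k (φ p.1) ≠ 0}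

theorem isConnected_simplePart (h : IsDiskModel D φ g H) (i : Fin n) :
    IsConnected (simplePart φ g H i) := by
  set C : Set R3 := {v | v ∈ φ.target ∧ g i v = 0 ∧
    ∃ j < i, ∃ k, k ≠ i ∧ k ≠ j ∧ g j v = 0 ∧ g k v = 0} with hC
  have hCc : C.Countable := (h.countable i).mono fun v hv => by
    obtain ⟨h1, h2, j, hj, k, h3, h4, h5, h6⟩ := hv
    exact ⟨h1, h2, j, k, hj.ne, h3, h4.symm, h5, h6⟩
  have himg : simplePart φ g H i =
      (fun v => ((φ.symm v, H i (φ.symm v)) : R4)) '' ({v | v ∈ φ.target ∧ g i v = 0} \ C) := by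
    ext p
    constructor
    · rintro ⟨hp, hd⟩
      refine ⟨φ p.1, ⟨⟨φ.map_source hp.1, hp.2.1⟩, ?_⟩, ?_⟩
      · rintro ⟨-, -, j, hj, k, h1, h2, h3, h4⟩
        exact hd j hj h3 k h1 h2 h4
      · dsimp only
        rw [φ.left_inv hp.1, ← hp.2.2]
    · rintro ⟨v, ⟨⟨h1, h2⟩, h3⟩, rfl⟩
      have hv : φ (φ.symm v) = v := φ.right_inv h1
      refine ⟨⟨φ.map_target h1, by rw [hv, h2], rfl⟩, fun j hj hj0 k hki hkj hk0 => h3 ?_⟩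
      simp only [hv] at hj0 hk0
      exact ⟨h1, h2, j, hj, k, hki, hkj, hj0, hk0⟩
  rw [himg]
  refine (h.connected i C hCc).image _ ?_
  refine ContinuousOn.mono (s := φ.target) ?_ fun v hv => hv.1.1
  exact φ.continuousOn_symm.prodMk
    (((h.graphs.1 i).continuousOn).comp φ.continuousOn_symm fun v hv => φ.map_target hv)

theorem exists_mem_cutSurface (h : IsDiskModel D φ g H) (i : Fin n) :
    ∃ p ∈ D.cutSurface, OnDisk φ g H i p := by
  obtain ⟨p, hp, hd⟩ := (h.isConnected_simplePart i).nonempty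
  exact closure_nonempty_iff.1 ⟨p, h.mem_closure_cutSurface hp hd⟩

variable {R : Type*} [Rack R]

/-- On the `i`-th disk, the coloring `c` is given by the base colors `a`. -/
def HasBaseColors (c : RackColoring R D) (φ : OpenPartialHomeomorph R3 R3) (g H : Fin n → R3 → ℝ)
    (a : Fin n → R) (i : Fin n) : Prop :=
  ∀ p (hp : p ∈ D.cutSurface), OnDisk φ g H i p → c.1 (D.sheet p hp) = diskColor g a i (φ p.1)

/-- Undoing the passage makes the color locally constant on the cut disk. Across a double curve the
color and the passage change by the same action, so the value is also constant near simple double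
points; connectedness of the simple part concludes. -/
theorem exists_passage_eq (h : IsDiskModel D φ g H) (c : RackColoring R D) {a : Fin n → R}
    {i : Fin n} (ha : ∀ j < i, HasBaseColors c φ g H a j) :
    ∃ r, ∀ p (hp : p ∈ D.cutSurface), OnDisk φ g H i p →
      c.1 (D.sheet p hp) = passage a (fun j => 0 < g j (φ p.1)) i r := by
  set T : Set R4 := {q | q ∈ D.cutSurface ∧ OnDisk φ g H i q} with hT
  have hTS : T ⊆ simplePart φ g H i := fun q hq =>
    ⟨hq.2, fun j hj h0 => absurd h0 (h.ne_zero_of_mem_cutSurface hq.2 hq.1 hj)⟩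
  obtain ⟨r, hr⟩ := IsConnected.exists_eq_of_eventually_eq (h.isConnected_simplePart i) hTS
    (fun q => (passage a (fun j => 0 < g j (φ q.1.1)) i)⁻¹ (c.1 (D.sheet q.1 q.2.1)))
    (fun p hp => h.mem_closure_cutSurface hp.1 hp.2) (by
      rintro p ⟨hp, hd⟩
      by_cases h0 : ∀ j < i, g j (φ p.1) ≠ 0
      · have hpc := h.mem_cutSurface hp h0
        refine ⟨(passage a (fun j => 0 < g j (φ p.1)) i)⁻¹ (c.1 (D.sheet p hpc)), ?_⟩
        filter_upwards [Diagram.eventually_sheet_eq hpc, h.eventually_sign hp.1] with q h1 h2 hq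
        rw [h1 hq.1]
        congr 2
        exact passage_congr (fun _ _ => rfl) fun j hj => (h2 j (h0 j hj)).2
      push Not at h0
      obtain ⟨j, hji, hj⟩ := h0
      obtain ⟨γ, w, P, N, hc, hx, hPc, hNc, hP, hN, hPg, hNg, hPN, hnear, hev⟩ :=
        h.exists_sides hp hji hj (hd j hji hj)
      have hxc := hc.mem_cutSurface
      obtain ⟨t, ⟨htP, htN⟩, h1, h2, hact⟩ := (hev.and (c.eventually_crosses hc hxc)).exists
      refine ⟨(passage a (fun j => 0 < g j (φ (γ t).1)) i)⁻¹ (c.1 (D.sheet _ h2)), ?_⟩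
      filter_upwards [hnear] with q hq hqT
      have hsame : ∀ {S : Set R4}, S ⊆ P ∪ N → (∀ u ∈ S, ∀ v ∈ S,
          (0 < g j (φ u.1) ↔ 0 < g j (φ v.1))) → ∀ u ∈ S, ∀ v ∈ S,
          passage a (fun j => 0 < g j (φ u.1)) i = passage a (fun j => 0 < g j (φ v.1)) i := by
        intro S hS hSj u hu v hv
        refine passage_congr (fun _ _ => rfl) fun k hk => ?_
        by_cases hkj : k = j
        · exact hkj ▸ hSj u hu v hv
        · exact ((hPN u (hS hu)).2 k hk.ne hkj).trans ((hPN v (hS hv)).2 k hk.ne hkj).symm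
      rcases hq hqT.1 with hqP | hqN
      · rw [Diagram.sheet_eq_of_isPreconnected hPc hP hqP htP,
          hsame subset_union_left (fun u hu v hv => iff_of_true (hPg u hu) (hPg v hv)) q hqP _ htP]
      -- On the negative side, the coloring condition along `γ` and `passage_eq_act` cancel, giving
      -- the value chosen on the positive side.
      · rw [Diagram.sheet_eq_of_isPreconnected hNc hN hqN htN,
          hsame subset_union_right (fun u hu v hv => iff_of_false (hNg u hu) (hNg v hv)) q hqN _ htN,
          eq_comm, Equiv.Perm.inv_eq_iff_eq, hact, ha j hji _ hxc hx]
        rw [passage_eq_act (P := fun k => 0 < g k (φ (γ (-t)).1)) hji (fun l hl hlj =>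
          ((hPN _ (Or.inl htP)).2 l hl.ne hlj).trans ((hPN _ (Or.inr htN)).2 l hl.ne hlj).symm)
          (hNg _ htN) (hPg _ htP)]
        congr 1
        · unfold diskColor
          congr 1
          exact passage_congr (fun _ _ => rfl) fun l hl =>
            ((hPN _ (Or.inr htN)).2 l (hl.trans hji).ne hl.ne).symm
        · simp)
  refine ⟨r, fun p hp hi => ?_⟩
  rw [← hr ⟨p, hp, hi⟩]
  simp

theorem HasBaseColors.congr {c : RackColoring R D} {a a' : Fin n → R} {i : Fin n}
    (ha : HasBaseColors c φ g H a i) (haa : ∀ j ≤ i, a j = a' j) :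
    HasBaseColors c φ g H a' i := fun p hp hi => by
  rw [ha p hp hi, diskColor, diskColor, haa i le_rfl,
    passage_congr (fun j hj => haa j hj.le) fun _ _ => Iff.rfl]

/-- Induction from the top disk downwards: the passage of a disk involves only base colors of higher
disks. -/
theorem exists_hasBaseColors (h : IsDiskModel D φ g H) (c : RackColoring R D) :
    ∃ a : Fin n → R, ∀ i, HasBaseColors c φ g H a i := by
  suffices hk : ∀ k : ℕ, ∃ a : Fin n → R, ∀ i : Fin n, i.1 < k → HasBaseColors c φ g H a i by
    obtain ⟨a, ha⟩ := hk n
    exact ⟨a, fun i => ha i i.2⟩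
  intro k
  induction k with
  | zero =>
    -- A rack may be empty, so even arbitrary initial values must be taken from colors that occur.
    have : ∀ i : Fin n, ∃ _ : R, True := fun i => by
      obtain ⟨p, hp, -⟩ := h.exists_mem_cutSurface i
      exact ⟨c.1 (D.sheet p hp), trivial⟩
    choose a _ using this
    exact ⟨a, fun i hi => absurd hi (Nat.not_lt_zero _)⟩
  | succ k ih =>
    obtain ⟨a, ha⟩ := ih
    by_cases hkn : k < n
    swap
    · exact ⟨a, fun i _ => ha i (by omega)⟩
    obtain ⟨r, hr⟩ := h.exists_passage_eq c (i := ⟨k, hkn⟩) (a := a) fun j hj => ha j hj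
    have hupd : ∀ j : Fin n, j.1 < k → a j = Function.update a ⟨k, hkn⟩ r j := fun j hj => by
      rw [Function.update_of_ne]
      rintro rfl
      exact hj.false
    refine ⟨Function.update a ⟨k, hkn⟩ r, fun i hi => ?_⟩
    rcases Nat.lt_succ_iff_lt_or_eq.1 hi with hlt | heq
    · exact (ha i hlt).congr fun j hj => hupd j (lt_of_le_of_lt hj hlt)
    · obtain rfl : i = ⟨k, hkn⟩ := Fin.ext heq
      intro p hp hpi
      rw [hr p hp hpi, diskColor, Function.update_self,
        passage_congr (fun j hj => hupd j hj) fun _ _ => Iff.rfl]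

/-- Once the higher base colors are known the passage is a known permutation, and one point of the
cut disk recovers `a i`. -/
theorem baseColors_unique (h : IsDiskModel D φ g H) {c : RackColoring R D} {a a' : Fin n → R}
    (ha : ∀ i, HasBaseColors c φ g H a i) (ha' : ∀ i, HasBaseColors c φ g H a' i) : a = a' := by
  funext i
  induction i using WellFoundedLT.induction with
  | ind i ih =>
    obtain ⟨p, hp, hi⟩ := h.exists_mem_cutSurface i
    have := (ha i p hp hi).symm.trans (ha' i p hp hi)
    rw [diskColor, diskColor, passage_congr ih fun _ _ => Iff.rfl] at this
    exact (passage a' _ i).injective this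

end IsDiskModel

/-! ### Replacing the disks inside a box -/

/-- Over the chart `φ`, the diagrams `D` and `D'` consist of disks with the same height order, which
have the same position with respect to each other outside the compact set `M` of coordinates. Outside
the chart, `D` and `D'` agree. -/
structure IsLocalChange (D D' : Diagram) (φ : OpenPartialHomeomorph R3 R3) {n : ℕ}
    (g g' H : Fin n → R3 → ℝ) (M : Set R3) : Prop where
  left : IsDiskModel D φ g H
  right : IsDiskModel D' φ g' H
  isCompact : IsCompact M
  subset : M ⊆ φ.target
  sign : ∀ v ∈ φ.target, v ∉ M → ∀ i, SignType.sign (g i v) = SignType.sign (g' i v)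
  carrier_iff : ∀ p : R4, p.1 ∉ φ.source → (p ∈ D.carrier ↔ p ∈ D'.carrier)
  side_iff : ∀ p : R4, p.1 ∉ φ.source → ∀ w, D.PositiveSide p w ↔ D'.PositiveSide p w

namespace IsLocalChange

variable {D D' : Diagram} {φ : OpenPartialHomeomorph R3 R3} {n : ℕ} {g g' H : Fin n → R3 → ℝ}
  {M : Set R3}

theorem symm (h : IsLocalChange D D' φ g g' H M) : IsLocalChange D' D φ g' g H M :=
  ⟨h.right, h.left, h.isCompact, h.subset, fun v hv hM i => (h.sign v hv hM i).symm,
    fun p hp => (h.carrier_iff p hp).symm, fun p hp w => (h.side_iff p hp w).symm⟩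

/-- Compactness of `M` makes its image closed in all of `ℝ³`, so nothing changes near the boundary
of the chart either. -/
theorem eventually_notMem (h : IsLocalChange D D' φ g g' H M) {p : R4}
    (hp : p.1 ∉ φ.symm '' M) : ∀ᶠ q : R4 in 𝓝 p, q.1 ∉ φ.symm '' M := by
  have hcl : IsClosed (φ.symm '' M) :=
    (h.isCompact.image_of_continuousOn (φ.continuousOn_symm.mono h.subset)).isClosed
  exact continuousAt_fst.eventually (hcl.isOpen_compl.mem_nhds hp)

theorem notMem_image (h : IsLocalChange D D' φ g g' H M) {q : R3} (hq : q ∉ φ.source) :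
    q ∉ φ.symm '' M := by
  rintro ⟨v, hv, rfl⟩
  exact hq (φ.map_target (h.subset hv))

theorem sign_eq (h : IsLocalChange D D' φ g g' H M) {q : R3} (hq : q ∈ φ.source)
    (hM : q ∉ φ.symm '' M) (i : Fin n) : SignType.sign (g i (φ q)) = SignType.sign (g' i (φ q)) :=
  h.sign _ (φ.map_source hq) (fun hv => hM ⟨_, hv, φ.left_inv hq⟩) i

theorem onDisk (h : IsLocalChange D D' φ g g' H M) {p : R4} (hM : p.1 ∉ φ.symm '' M) {i : Fin n}
    (hp : OnDisk φ g H i p) : OnDisk φ g' H i p := by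
  refine ⟨hp.1, ?_, hp.2.2⟩
  rw [← sign_eq_zero_iff, ← h.sign_eq hp.1 hM, sign_eq_zero_iff]
  exact hp.2.1

theorem mem_carrier (h : IsLocalChange D D' φ g g' H M) {p : R4} (hM : p.1 ∉ φ.symm '' M)
    (hp : p ∈ D.carrier) : p ∈ D'.carrier := by
  by_cases hs : p.1 ∈ φ.source
  · obtain ⟨i, hi⟩ := h.left.exists_onDisk hp hs
    exact h.right.mem_carrier (h.onDisk hM hi)
  · exact (h.carrier_iff p hs).1 hp

theorem mem_cutSurface (h : IsLocalChange D D' φ g g' H M) {p : R4} (hM : p.1 ∉ φ.symm '' M)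
    (hp : p ∈ D.cutSurface) : p ∈ D'.cutSurface := by
  refine ⟨h.mem_carrier hM hp.1, fun hcl => hp.2 (mem_closure_iff_frequently.2 ?_)⟩
  refine ((mem_closure_iff_frequently.1 hcl).and_eventually (h.eventually_notMem hM)).mono ?_
  rintro q ⟨⟨h1, q', h2, h3, h4⟩, h5⟩
  exact ⟨h.symm.mem_carrier h5 h1, q', h.symm.mem_carrier (h3.symm ▸ h5) h2, h3, h4⟩

theorem crosses (h : IsLocalChange D D' φ g g' H M) {x y : R4} {γ : ℝ → R4} {w : R3}
    (hx : x.1 ∉ φ.source) (hc : D.Crosses x y γ w) : D'.Crosses x y γ w := by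
  refine ⟨?_, hc.lt, hc.zero, hc.cont, ?_, hc.deriv, (h.side_iff x hx w).1 hc.side⟩
  · rw [← hc.fibre]
    ext p
    refine and_congr_left fun hp => (h.carrier_iff p ?_).symm
    rw [hp]; exact hx
  · filter_upwards [hc.mem, hc.cont.eventually (h.eventually_notMem (p := γ 0)
      (by rw [hc.zero, hc.fst_eq]; exact h.notMem_image hx))] with t h1 h2
    exact h.mem_carrier h2 h1

variable {R : Type*} [Rack R]

theorem diskColor_eq (h : IsLocalChange D D' φ g g' H M) (a : Fin n → R) {q : R3}
    (hq : q ∈ φ.source) (hM : q ∉ φ.symm '' M) (i : Fin n) :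
    diskColor g a i (φ q) = diskColor g' a i (φ q) := by
  unfold diskColor
  rw [passage_congr (fun _ _ => rfl) fun j _ => ?_]
  rw [← sign_eq_one_iff, h.sign_eq hq hM, sign_eq_one_iff]

/-- Two colorings correspond if they agree outside the change and have the same base colors. -/
structure Corresponds (c : RackColoring R D) (c' : RackColoring R D')
    (φ : OpenPartialHomeomorph R3 R3) (g g' H : Fin n → R3 → ℝ) (M : Set R3) : Prop where
  eq : ∀ p hp hp', p.1 ∉ φ.symm '' M → c.1 (D.sheet p hp) = c'.1 (D'.sheet p hp')
  base : ∃ a, (∀ i, IsDiskModel.HasBaseColors c φ g H a i) ∧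
    ∀ i, IsDiskModel.HasBaseColors c' φ g' H a i

theorem Corresponds.symm {c : RackColoring R D} {c' : RackColoring R D'}
    (hc : Corresponds c c' φ g g' H M) : Corresponds c' c φ g' g H M :=
  ⟨fun p hp hp' hM => (hc.eq p hp' hp hM).symm, hc.base.imp fun _ ha => ha.symm⟩

/-- The coloring `c'` determines the base colors, hence the other coloring over the chart; elsewhere
the two agree directly. -/
theorem Corresponds.unique (h : IsLocalChange D D' φ g g' H M) {c₁ c₂ : RackColoring R D}
    {c' : RackColoring R D'} (h₁ : Corresponds c₁ c' φ g g' H M)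
    (h₂ : Corresponds c₂ c' φ g g' H M) : c₁ = c₂ := by
  obtain ⟨a₁, ha₁, ha₁'⟩ := h₁.base
  obtain ⟨a₂, ha₂, ha₂'⟩ := h₂.base
  obtain rfl := h.right.baseColors_unique ha₁' ha₂'
  refine RackColoring.ext_sheet fun p hp => ?_
  by_cases hs : p.1 ∈ φ.source
  · obtain ⟨i, hi⟩ := h.left.exists_onDisk hp.1 hs
    rw [ha₁ i p hp hi, ha₂ i p hp hi]
  · have hM := h.notMem_image hs
    have hp' := h.mem_cutSurface hM hp
    rw [h₁.eq p hp hp' hM, h₂.eq p hp hp' hM]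

theorem exists_corresponds (h : IsLocalChange D D' φ g g' H M) (c : RackColoring R D) :
    ∃ c' : RackColoring R D', Corresponds c c' φ g g' H M := by
  obtain ⟨a, ha⟩ := h.left.exists_hasBaseColors c
  -- The prescriptions by base colors and by `c` overlap over the chart outside `M`, where they
  -- agree because disk colors depend only on signs.
  have hval : ∀ q : D'.cutSurface, ∃ r,
      (∀ i, OnDisk φ g' H i q.1 → r = diskColor g' a i (φ q.1.1)) ∧
      ∀ hq : q.1 ∈ D.cutSurface, q.1.1 ∉ φ.symm '' M → r = c.1 (D.sheet q.1 hq) := by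
    rintro ⟨q, hq⟩
    by_cases hs : q.1 ∈ φ.source
    · obtain ⟨i, hi⟩ := h.right.exists_onDisk hq.1 hs
      refine ⟨diskColor g' a i (φ q.1), fun j hj => by rw [h.right.eq_of_onDisk hi hj],
        fun hq' hM => ?_⟩
      rw [ha i q hq' (h.symm.onDisk hM hi)]
      exact (h.diskColor_eq a hs hM i).symm
    · exact ⟨c.1 (D.sheet q (h.symm.mem_cutSurface (h.notMem_image hs) hq)),
        fun i hi => absurd hi.1 hs, fun _ _ => rfl⟩
  choose f hf hf' using hval
  obtain ⟨c', hc'⟩ := RackColoring.exists_of_isLocallyConstant f (by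
    rw [IsLocallyConstant.iff_eventually_eq]
    rintro ⟨q, hq⟩
    by_cases hs : q.1 ∈ φ.source
    · obtain ⟨i, hi⟩ := h.right.exists_onDisk hq.1 hs
      filter_upwards [continuousAt_subtype_val.eventually (h.right.eventually_onDisk hi),
        continuousAt_subtype_val.eventually (h.right.eventually_sign hi.1)] with z h1 h2
      rw [hf z i (h1 z.2.1), hf ⟨q, hq⟩ i hi]
      unfold diskColor
      rw [passage_congr (fun _ _ => rfl) fun j hj =>
        (h2 j (h.right.ne_zero_of_mem_cutSurface hi hq hj)).2]
    · have hM := h.notMem_image hs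
      have hq' := h.symm.mem_cutSurface hM hq
      filter_upwards [continuousAt_subtype_val.eventually (h.eventually_notMem (p := q) hM),
        continuousAt_subtype_val.eventually (Diagram.eventually_sheet_eq hq')] with z h1 h2
      have hz := h.symm.mem_cutSurface h1 z.2
      rw [hf' z hz h1, hf' ⟨q, hq⟩ hq' hM, h2 hz]) (by
    intro x y γ w hc hx
    by_cases hs : x.1 ∈ φ.source
    · obtain ⟨j, hj⟩ := h.right.exists_onDisk hc.mem_upper hs
      obtain ⟨i, hi⟩ := h.right.exists_onDisk hc.mem_lower (hc.fst_eq ▸ hs)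
      filter_upwards [h.right.eventually_diskColor_eq hc hj hi a] with t ⟨⟨d1, d2⟩, ht⟩ h1 h2
      rw [hf ⟨γ t, h2⟩ i d1, hf ⟨γ (-t), h1⟩ i d2, hf ⟨x, hx⟩ j hj]
      exact ht
    · have hM := h.notMem_image hs
      have hx' := h.symm.mem_cutSurface hM hx
      have hev := hc.cont.eventually (h.eventually_notMem (p := γ 0)
        (by rw [hc.zero, hc.fst_eq]; exact hM))
      filter_upwards [c.eventually_crosses (h.symm.crosses hs hc) hx', eventually_and_neg hev]
        with t ⟨h1, h2, ht⟩ ⟨m1, m2⟩ h1' h2'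
      rw [hf' ⟨γ t, h2'⟩ h2 m1, hf' ⟨γ (-t), h1'⟩ h1 m2, hf' ⟨x, hx⟩ hx' hM]
      exact ht)
  refine ⟨c', fun p hp hp' hM => ?_, a, ha, fun i p hp hi => ?_⟩
  · rw [hc', hf' ⟨p, hp'⟩ hp hM]
  · rw [hc', hf ⟨p, hp⟩ i hi]

theorem nonempty_equiv (h : IsLocalChange D D' φ g g' H M) :
    Nonempty (RackColoring R D ≃ RackColoring R D') := by
  choose F hF using h.exists_corresponds (R := R)
  choose F' hF' using h.symm.exists_corresponds (R := R)
  exact ⟨⟨F, F', fun c => Corresponds.unique h (hF' (F c)).symm (hF c),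
    fun c => Corresponds.unique h.symm (hF (F' c)).symm (hF' c)⟩⟩

end IsLocalChange

/-! ### Geometry of the local models -/

/-- An open rectangle remains connected after removal of countably many points. -/
theorem isConnected_rectangle_diff {a b : ℝ} (ha : 0 < a) (hb : 0 < b) {C : Set (ℝ × ℝ)}
    (hC : C.Countable) : IsConnected ({u : ℝ × ℝ | |u.1| < a ∧ |u.2| < b} \ C) := by
  -- A rescaled arctangent maps `ℝ` onto `(-c, c)`, reducing the rectangle to the plane.
  set f : ℝ → ℝ → ℝ := fun c x => c * (2 / Real.pi) * Real.arctan x with hf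
  have hinj : ∀ c, 0 < c → Function.Injective (f c) := fun c hc x y hxy =>
    Real.arctan_injective (mul_left_cancel₀ (by positivity) hxy)
  have hcont : ∀ c, Continuous (f c) := fun c => continuous_const.mul Real.continuous_arctan
  have hrange : ∀ c, 0 < c → ∀ y, (|y| < c ↔ ∃ x, f c x = y) := by
    intro c hc y
    have hpi := Real.pi_pos
    constructor
    · intro hy
      rw [abs_lt] at hy
      have : y * Real.pi / (2 * c) ∈ range Real.arctan := by
        rw [Real.range_arctan]
        constructor
        · rw [lt_div_iff₀ (by positivity)]; nlinarith
        · rw [div_lt_iff₀ (by positivity)]; nlinarith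
      obtain ⟨x, hx⟩ := this
      refine ⟨x, ?_⟩
      simp only [hf, hx]
      field_simp
    · rintro ⟨x, rfl⟩
      have h1 := Real.neg_pi_div_two_lt_arctan x
      have h2 := Real.arctan_lt_pi_div_two x
      have h3 : f c x = c * (Real.arctan x * (2 / Real.pi)) := by simp only [hf]; ring
      rw [h3, abs_mul, abs_of_pos hc, abs_mul, abs_of_pos (by positivity : 0 < 2 / Real.pi)]
      have h4 : |Real.arctan x| < Real.pi / 2 := abs_lt.2 ⟨by linarith, h2⟩
      have h5 : |Real.arctan x| * (2 / Real.pi) < 1 := by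
        rw [mul_div_assoc', div_lt_one hpi]; linarith
      nlinarith
  set F : ℝ × ℝ → ℝ × ℝ := Prod.map (f a) (f b) with hF
  have hFinj : Function.Injective F := (hinj a ha).prodMap (hinj b hb)
  have hrank : 1 < Module.rank ℝ (ℝ × ℝ) := by
    rw [rank_prod', Module.rank_self]; norm_num
  have himg : {u : ℝ × ℝ | |u.1| < a ∧ |u.2| < b} \ C = F '' (F ⁻¹' C)ᶜ := by
    ext u
    constructor
    · rintro ⟨⟨h1, h2⟩, h3⟩
      obtain ⟨x, hx⟩ := (hrange a ha _).1 h1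
      obtain ⟨y, hy⟩ := (hrange b hb _).1 h2
      have hu : F (x, y) = u := Prod.ext hx hy
      exact ⟨(x, y), fun h => h3 (hu ▸ h), hu⟩
    · rintro ⟨z, hz, rfl⟩
      exact ⟨⟨(hrange a ha _).2 ⟨z.1, rfl⟩, (hrange b hb _).2 ⟨z.2, rfl⟩⟩, hz⟩
  rw [himg]
  exact ((hC.preimage hFinj).isConnected_compl_of_one_lt_rank hrank).image _
    ((hcont a).prodMap (hcont b)).continuousOn

theorem isConnected_image_rectangle_diff {X : Type*} [TopologicalSpace X] {a b : ℝ} (ha : 0 < a)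
    (hb : 0 < b) {F : ℝ × ℝ → X} (hF : Continuous F) (hinj : Function.Injective F) {C : Set X}
    (hC : C.Countable) : IsConnected (F '' {u : ℝ × ℝ | |u.1| < a ∧ |u.2| < b} \ C) := by
  have := (isConnected_rectangle_diff ha hb (hC.preimage hinj)).image F hF.continuousOn
  convert this using 1
  ext x
  constructor
  · rintro ⟨⟨u, hu, rfl⟩, hx⟩
    exact ⟨u, ⟨hu, hx⟩, rfl⟩
  · rintro ⟨u, ⟨hu, hx⟩, rfl⟩
    exact ⟨⟨u, hu, rfl⟩, hx⟩

theorem continuous_bump : Continuous bump := by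
  unfold bump
  fun_prop

theorem bump_nonneg (v : R3) : 0 ≤ bump v := Real.smoothTransition.nonneg _

theorem bump_le_one (v : R3) : bump v ≤ 1 := Real.smoothTransition.le_one _

theorem bump_eq_one {v : R3} (hv : v 0 ^ 2 + v 1 ^ 2 ≤ 1) : bump v = 1 :=
  Real.smoothTransition.one_of_one_le (by linarith)

theorem bump_eq_zero {v : R3} (hv : 2 ≤ v 0 ^ 2 + v 1 ^ 2) : bump v = 0 :=
  Real.smoothTransition.zero_of_nonpos (by linarith)

theorem abs_mul_bump_le {t : ℝ} (ht : |t| ≤ 1 / 8) (v : R3) : |t * bump v| ≤ 1 / 8 := by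
  rw [abs_mul, abs_of_nonneg (bump_nonneg v)]
  exact (mul_le_of_le_one_right (abs_nonneg t) (bump_le_one v)).trans ht

/-- A disk of a model is a coordinate plane or a graph over the `x, y`-plane. -/
theorem MoveType.model_cases (m : MoveType) (i : Fin m.disks) :
    (∃ l : Fin 3, ∀ t v, m.model t i v = v l) ∨
    ∃ k : R3 → ℝ, Continuous k ∧ (∀ v ∈ box, |k v| ≤ 8) ∧
      (∀ v w : R3, v 0 = w 0 → v 1 = w 1 → k v = k w) ∧
      ∀ t v, m.model t i v = v 2 - (k v + t * bump v) := by
  have hsq : ∀ x : ℝ, |x| < 2 → x ^ 2 < 4 := fun x hx => by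
    rw [← sq_abs]; nlinarith [abs_nonneg x]
  cases m
  case D1 =>
    change Fin 2 at i
    fin_cases i
    · exact Or.inl ⟨2, fun t v => rfl⟩
    · refine Or.inr ⟨fun v => v 0 ^ 2 + v 1 ^ 2, by fun_prop, fun v hv => ?_,
        fun v w h0 h1 => by simp only [h0, h1], fun t v => rfl⟩
      rw [abs_le]
      constructor <;> nlinarith [hsq _ hv.1, hsq _ hv.2.1]
  case D2 =>
    change Fin 2 at i
    fin_cases i
    · exact Or.inl ⟨2, fun t v => rfl⟩
    · refine Or.inr ⟨fun v => v 0 ^ 2 - v 1 ^ 2, by fun_prop, fun v hv => ?_,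
        fun v w h0 h1 => by simp only [h0, h1], fun t v => rfl⟩
      rw [abs_le]
      constructor <;> nlinarith [hsq _ hv.1, hsq _ hv.2.1]
  case T1 =>
    change Fin 3 at i
    fin_cases i
    · exact Or.inl ⟨2, fun t v => rfl⟩
    · exact Or.inl ⟨1, fun t v => rfl⟩
    · refine Or.inr ⟨fun v => v 0 ^ 2 - v 1, by fun_prop, fun v hv => ?_,
        fun v w h0 h1 => by simp only [h0, h1], fun t v => ?_⟩
      · have := abs_lt.1 hv.2.1
        rw [abs_le]
        constructor <;> nlinarith [hsq _ hv.1]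
      · change v 1 + v 2 - (v 0 ^ 2 + t * bump v) = _
        ring
  case T2 =>
    change Fin 4 at i
    fin_cases i
    · exact Or.inl ⟨0, fun t v => rfl⟩
    · exact Or.inl ⟨1, fun t v => rfl⟩
    · exact Or.inl ⟨2, fun t v => rfl⟩
    · refine Or.inr ⟨fun v => -v 0 - v 1, by fun_prop, fun v hv => ?_,
        fun v w h0 h1 => by simp only [h0, h1], fun t v => ?_⟩
      · have h0 := abs_lt.1 hv.1
        have h1 := abs_lt.1 hv.2.1
        rw [abs_le]
        constructor <;> linarith
      · change v 0 + v 1 + v 2 - t * bump v = _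
        ring

theorem MoveType.continuous_model (m : MoveType) (t : ℝ) (i : Fin m.disks) :
    Continuous (m.model t i) := by
  rcases m.model_cases i with ⟨l, hl⟩ | ⟨k, hk, -, -, hm⟩
  · rw [funext (hl t)]; exact continuous_apply l
  · rw [funext (hm t)]
    exact (continuous_apply 2).sub (hk.add (continuous_const.mul continuous_bump))

/-- The part of the box in which a move changes the position of the disks. -/
def core : Set R3 := {v | v 0 ^ 2 + v 1 ^ 2 ≤ 2 ∧ |v 2| ≤ 9}

theorem core_subset_box : core ⊆ box := by
  rintro v ⟨h1, h2⟩
  refine ⟨abs_lt.2 ⟨?_, ?_⟩, abs_lt.2 ⟨?_, ?_⟩, by linarith⟩ <;>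
    nlinarith [sq_nonneg (v 0), sq_nonneg (v 1)]

theorem isCompact_core : IsCompact core := by
  refine Metric.isCompact_of_isClosed_isBounded ?_ ?_
  · exact (isClosed_le (f := fun v : R3 => v 0 ^ 2 + v 1 ^ 2) (by fun_prop) continuous_const).inter
      (isClosed_le (f := fun v : R3 => |v 2|) (by fun_prop) continuous_const)
  · refine (Metric.isBounded_Icc (fun _ => -10 : R3) (fun _ => 10)).subset fun v hv => ?_
    obtain ⟨h0, h1, h2⟩ := core_subset_box hv
    rw [abs_lt] at h0 h1 h2
    refine ⟨fun i => ?_, fun i => ?_⟩ <;> fin_cases i <;> dsimp <;> linarith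

theorem MoveType.sign_model_eq (m : MoveType) {t t' : ℝ} (ht : |t| ≤ 1 / 8) (ht' : |t'| ≤ 1 / 8)
    {v : R3} (hv : v ∈ box) (hc : v ∉ core) (i : Fin m.disks) :
    SignType.sign (m.model t i v) = SignType.sign (m.model t' i v) := by
  rcases m.model_cases i with ⟨l, hl⟩ | ⟨k, -, hb, -, hm⟩
  · rw [hl, hl]
  rw [hm, hm]
  -- Either the cut-off vanishes, or `|v 2| > 9` exceeds the height bound `8 + 1/8` of the moving
  -- disk.
  rcases le_or_gt 2 (v 0 ^ 2 + v 1 ^ 2) with h2 | h2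
  · rw [bump_eq_zero h2, mul_zero, mul_zero]
  · have h9 : 9 < |v 2| := by
      by_contra! h
      exact hc ⟨h2.le, h⟩
    have h8 := abs_le.1 (hb v hv)
    have h1 := abs_le.1 (abs_mul_bump_le ht v)
    have h1' := abs_le.1 (abs_mul_bump_le ht' v)
    rcases lt_abs.1 h9 with h | h
    · rw [sign_pos (by linarith), sign_pos (by linarith)]
    · rw [sign_neg (by linarith), sign_neg (by linarith)]

/-- Triple points lie where the cut-off is `1`, so the uncut equations can be solved: at most two
solutions for `T1`, four for `T2`. -/
theorem MoveType.countable_multiple (m : MoveType) {t : ℝ} (ht : |t| ≤ 1 / 8) (i : Fin m.disks) :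
    {v | v ∈ box ∧ m.model t i v = 0 ∧
      ∃ j k, j ≠ i ∧ k ≠ i ∧ j ≠ k ∧ m.model t j v = 0 ∧ m.model t k v = 0}.Countable := by
  have hext : ∀ v : R3, ∀ a b c : ℝ, v 0 = a → v 1 = b → v 2 = c → v = ![a, b, c] := by
    rintro v _ _ _ rfl rfl rfl
    ext i; fin_cases i <;> rfl
  have hsmall : ∀ x : ℝ, |x| ≤ 1 / 8 → x ^ 2 ≤ 1 := fun x hx => by
    rw [← sq_abs]; nlinarith [abs_nonneg x]
  have htb := abs_mul_bump_le ht
  cases m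
  case D1 =>
    refine Set.countable_empty.mono ?_
    rintro v ⟨-, -, j, k, h1, h2, h3, -⟩
    change Fin 2 at i j k
    have := Fin.ext_iff.not.1 h1
    have := Fin.ext_iff.not.1 h2
    have := Fin.ext_iff.not.1 h3
    omega
  case D2 =>
    refine Set.countable_empty.mono ?_
    rintro v ⟨-, -, j, k, h1, h2, h3, -⟩
    change Fin 2 at i j k
    have := Fin.ext_iff.not.1 h1
    have := Fin.ext_iff.not.1 h2
    have := Fin.ext_iff.not.1 h3
    omega
  case T1 =>
    -- For `t > 0` there is no triple point; the square root is then `0` by default and the set is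
    -- merely too large.
    refine ((Set.toFinite {![Real.sqrt (-t), 0, 0], ![-Real.sqrt (-t), 0, 0]}).countable).mono ?_
    rintro v ⟨-, h0, j, k, h1, h2, h3, h4, h5⟩
    change Fin 3 at i j k
    have hall : ∀ l : Fin 3, MoveType.T1.model t l v = 0 := by
      intro l
      have hl : ∀ i j k l : Fin 3, j ≠ i → k ≠ i → j ≠ k → l = i ∨ l = j ∨ l = k := by decide
      replace hl := hl i j k l h1 h2 h3
      rcases hl with rfl | rfl | rfl <;> assumption
    have e2 : v 2 = 0 := hall 0
    have e1 : v 1 = 0 := hall 1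
    have e0 : v 1 + v 2 - (v 0 ^ 2 + t * bump v) = 0 := hall 2
    have hb := abs_le.1 (htb v)
    rw [bump_eq_one (by rw [e1]; nlinarith)] at e0
    have e3 : v 0 ^ 2 = -t := by linarith
    have e4 : v 0 ^ 2 = Real.sqrt (-t) ^ 2 := by
      rw [Real.sq_sqrt (by rw [← e3]; positivity), e3]
    rcases sq_eq_sq_iff_eq_or_eq_neg.1 e4 with h | h
    · exact Or.inl (hext v _ _ _ h e1 e2)
    · exact Or.inr (hext v _ _ _ h e1 e2)
  case T2 =>
    refine ((Set.toFinite {![0, 0, 0], ![0, 0, t], ![0, t, 0], ![t, 0, 0]}).countable).mono ?_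
    rintro v ⟨-, h0, j, k, h1, h2, h3, h4, h5⟩
    change Fin 4 at i j k
    have hall : ∃ l : Fin 4, ∀ l' ≠ l, MoveType.T2.model t l' v = 0 := by
      have hl : ∀ i j k : Fin 4, j ≠ i → k ≠ i → j ≠ k →
          ∃ l, ∀ l' ≠ l, l' = i ∨ l' = j ∨ l' = k := by decide
      obtain ⟨l, hl⟩ := hl i j k h1 h2 h3
      refine ⟨l, fun l' hl' => ?_⟩
      rcases hl l' hl' with rfl | rfl | rfl <;> assumption
    obtain ⟨l, hl⟩ := hall
    have z0 : l ≠ 0 → v 0 = 0 := fun h => hl 0 h.symm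
    have z1 : l ≠ 1 → v 1 = 0 := fun h => hl 1 h.symm
    have z2 : l ≠ 2 → v 2 = 0 := fun h => hl 2 h.symm
    have z3 : l ≠ 3 → v 0 + v 1 + v 2 - t * bump v = 0 := fun h => hl 3 h.symm
    have hone : l ≠ 3 → v 0 ^ 2 + v 1 ^ 2 ≤ 1 → v 0 + v 1 + v 2 = t := fun h h' => by
      have := z3 h
      rw [bump_eq_one h'] at this
      linarith
    have hb := htb v
    fin_cases l
    -- The remaining coordinate equals `t * bump v`, so it is at most `1/8` in absolute value; this
    -- forces `bump v = 1` and the coordinate is `t`.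
    · have e1 := z1 (by decide)
      have e2 := z2 (by decide)
      have e3 := z3 (by decide)
      rw [e1, e2, add_zero, add_zero, sub_eq_zero] at e3
      have := hone (by decide) (by rw [e1]; have := hsmall _ (e3 ▸ hb); linarith)
      exact Or.inr (Or.inr (Or.inr (hext v _ _ _ (by linarith) e1 e2)))
    · have e1 := z0 (by decide)
      have e2 := z2 (by decide)
      have e3 := z3 (by decide)
      rw [e1, e2, add_zero, zero_add, sub_eq_zero] at e3
      have := hone (by decide) (by rw [e1]; have := hsmall _ (e3 ▸ hb); linarith)
      exact Or.inr (Or.inr (Or.inl (hext v _ _ _ e1 (by linarith) e2)))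
    · have e1 := z0 (by decide)
      have e2 := z1 (by decide)
      have := hone (by decide) (by rw [e1, e2]; norm_num)
      exact Or.inr (Or.inl (hext v _ _ _ e1 e2 (by linarith)))
    · exact Or.inl (hext v _ _ _ (z0 (by decide)) (z1 (by decide)) (z2 (by decide)))

/-- Each disk is an injective continuous image of an open rectangle; graphs stay below height `8 +
1/8 < 10` and so never leave the box vertically. -/
theorem MoveType.isConnected_disk_diff (m : MoveType) {t : ℝ} (ht : |t| ≤ 1 / 8) (i : Fin m.disks)
    {C : Set R3} (hC : C.Countable) : IsConnected ({v | v ∈ box ∧ m.model t i v = 0} \ C) := by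
  have hvec : Continuous fun u : ℝ × ℝ => (![u.1, u.2, 0] : R3) := by fun_prop
  have hgraph : ∀ k : R3 → ℝ, Continuous k → (∀ v ∈ box, |k v| < 10) →
      (∀ v w : R3, v 0 = w 0 → v 1 = w 1 → k v = k w) →
      IsConnected ({v | v ∈ box ∧ v 2 = k v} \ C) := by
    intro k hk hb hw
    have := isConnected_image_rectangle_diff (X := R3) two_pos two_pos
      (F := fun u : ℝ × ℝ => ![u.1, u.2, k ![u.1, u.2, 0]])
      (by have := hk.comp hvec; fun_prop)
      (fun u u' h => Prod.ext (congrFun h 0) (congrFun h 1)) hC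
    convert this using 2
    ext v
    constructor
    · rintro ⟨⟨h0, h1, -⟩, h2⟩
      refine ⟨(v 0, v 1), ⟨h0, h1⟩, ?_⟩
      ext i
      fin_cases i
      · rfl
      · rfl
      · exact (hw ![v 0, v 1, 0] v rfl rfl).trans h2.symm
    · rintro ⟨⟨x, y⟩, ⟨h0, h1⟩, rfl⟩
      have hbox : (![x, y, 0] : R3) ∈ box := ⟨h0, h1, by simp⟩
      exact ⟨⟨h0, h1, hb _ hbox⟩, hw _ _ rfl rfl⟩
  rcases m.model_cases i with ⟨l, hl⟩ | ⟨k, hk, hb, hw, hm⟩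
  · simp only [hl]
    fin_cases l
    · have := isConnected_image_rectangle_diff (X := R3) two_pos (show (0 : ℝ) < 10 by norm_num)
        (F := fun u : ℝ × ℝ => ![0, u.1, u.2]) (by fun_prop)
        (fun u u' h => Prod.ext (congrFun h 1) (congrFun h 2)) hC
      convert this using 2
      ext v
      constructor
      · rintro ⟨⟨-, h1, h2⟩, h0⟩
        refine ⟨(v 1, v 2), ⟨h1, h2⟩, ?_⟩
        ext i
        fin_cases i
        exacts [h0.symm, rfl, rfl]
      · rintro ⟨⟨x, y⟩, ⟨h0, h1⟩, rfl⟩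
        exact ⟨⟨by simp, h0, h1⟩, rfl⟩
    · have := isConnected_image_rectangle_diff (X := R3) two_pos (show (0 : ℝ) < 10 by norm_num)
        (F := fun u : ℝ × ℝ => ![u.1, 0, u.2]) (by fun_prop)
        (fun u u' h => Prod.ext (congrFun h 0) (congrFun h 2)) hC
      convert this using 2
      ext v
      constructor
      · rintro ⟨⟨h1, -, h2⟩, h0⟩
        refine ⟨(v 0, v 2), ⟨h1, h2⟩, ?_⟩
        ext i
        fin_cases i
        exacts [rfl, h0.symm, rfl]
      · rintro ⟨⟨x, y⟩, ⟨h0, h1⟩, rfl⟩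
        exact ⟨⟨h0, by simp, h1⟩, rfl⟩
    · exact hgraph (fun _ => 0) continuous_const (fun v _ => by simp) fun _ _ _ _ => rfl
  · simp only [hm, sub_eq_zero]
    refine hgraph (fun v => k v + t * bump v) (hk.add (continuous_const.mul continuous_bump)) ?_ ?_
    · intro v hv
      have h1 := abs_add_le (k v) (t * bump v)
      have h2 := hb v hv
      have h3 := abs_mul_bump_le ht v
      linarith
    · intro v w h0 h1
      simp only [hw v w h0 h1, bump, h0, h1]

/-! ### From moves to exchanges of disks -/

theorem isPreconnected_box : IsPreconnected box := by
  refine Convex.isPreconnected ?_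
  have h : ∀ i : Fin 3, ∀ c : ℝ, Convex ℝ {v : R3 | |v i| < c} := fun i c => by
    have : {v : R3 | |v i| < c} = LinearMap.proj (R := ℝ) (φ := fun _ => ℝ) i ⁻¹' Ioo (-c) c := by
      ext v; exact abs_lt (a := v i)
    rw [this]
    exact (convex_Ioo _ _).linear_preimage _
  exact (h 0 2).inter ((h 1 2).inter (h 2 10))

/-- Heights that never coincide keep their order over a connected chart, so sorting them at one
point is enough. -/
theorem exists_perm_strictAnti {n : ℕ} {φ : OpenPartialHomeomorph R3 R3} {H : Fin n → R3 → ℝ}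
    (hs : IsConnected φ.source) (hc : ∀ i, ContinuousOn (H i) φ.source)
    (hne : ∀ i j, i ≠ j → ∀ q ∈ φ.source, H i q ≠ H j q) :
    ∃ σ : Equiv.Perm (Fin n), ∀ q ∈ φ.source, ∀ i j, i < j → H (σ j) q < H (σ i) q := by
  obtain ⟨q₀, hq₀⟩ := hs.nonempty
  set σ := Tuple.sort fun i => -H i q₀ with hσ
  refine ⟨σ, fun q hq i j hij => ?_⟩
  have hmono := Tuple.monotone_sort fun i => -H i q₀
  have h1 : H (σ j) q₀ ≤ H (σ i) q₀ := neg_le_neg_iff.1 (hmono hij.le)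
  have hσij : σ j ≠ σ i := fun h => hij.ne' (σ.injective h)
  have h2 : H (σ j) q₀ < H (σ i) q₀ := lt_of_le_of_ne h1 (hne _ _ hσij _ hq₀)
  refine sub_pos.1 (IsPreconnected.pos_of_ne_zero hs.isPreconnected
    (f := fun q => H (σ i) q - H (σ j) q) ((hc _).sub (hc _)) (fun z hz h0 => ?_) hq₀ hq
    (sub_pos.2 h2))
  exact hne _ _ hσij z hz (sub_eq_zero.1 h0).symm

/-- Relabelling by `σ` orders the disks from the top, and the signs `s` turn each equation so that
it increases in the normal direction. -/
theorem MoveType.isDiskModel (m : MoveType) {t : ℝ} (ht : |t| ≤ 1 / 8) {D : Diagram}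
    {φ : OpenPartialHomeomorph R3 R3} (hφ : φ.target = box) {H : Fin m.disks → R3 → ℝ}
    {s : Fin m.disks → ℤˣ} (hg : IsGraphs D.carrier φ (m.model t) H)
    (hn : HasNormals D.toSurfaceKnot φ (m.model t) H s) (σ : Equiv.Perm (Fin m.disks))
    (hσ : ∀ q ∈ φ.source, ∀ i j, i < j → H (σ j) q < H (σ i) q) :
    IsDiskModel D φ (fun i v => ((s (σ i) : ℤ) : ℝ) * m.model t (σ i) v) (fun i => H (σ i)) := by
  have hs : ∀ i, ((s i : ℤ) : ℝ) ≠ 0 := fun i => Int.cast_ne_zero.2 (s i).ne_zero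
  have hz : ∀ i v, ((s i : ℤ) : ℝ) * m.model t i v = 0 ↔ m.model t i v = 0 := fun i v => by
    simp [hs i]
  refine ⟨⟨fun i => hg.1 _, fun i j hij => hg.2.1 _ _ (σ.injective.ne hij), fun p hp => ?_⟩, hσ,
    fun p hp i hi w => ?_, fun i => continuous_const.mul (m.continuous_model t _), fun i C hC => ?_,
    fun i => ?_⟩
  · rw [hg.2.2 p hp, ← σ.exists_congr_right]
    simp only [hz]
  · rw [hn p hp hi.1 (σ i) ((hz _ _).1 hi.2.1) hi.2.2 w]
    rcases Int.units_eq_one_or (s (σ i)) with h | h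
    · simp [h]
    · simp only [h, Units.val_neg, Units.val_one, Int.cast_neg, Int.cast_one, neg_mul, one_mul]
      have : (fun v => -m.model t (σ i) v) ∘ φ = fun q => -(m.model t (σ i) ∘ φ) q := rfl
      rw [this, fderiv_fun_neg]
      simp
  · simp only [hz, hφ]
    exact m.isConnected_disk_diff ht _ hC
  · refine (m.countable_multiple ht (σ i)).mono ?_
    rintro v ⟨h1, h2, j, k, h3, h4, h5, h6, h7⟩
    exact ⟨hφ ▸ h1, (hz _ _).1 h2, σ j, σ k, σ.injective.ne h3, σ.injective.ne h4,
      σ.injective.ne h5, (hz _ _).1 h6, (hz _ _).1 h7⟩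

theorem Move.nonempty_equiv {m : MoveType} {D D' : Diagram} (h : Move m D D')
    {R : Type*} [Rack R] : Nonempty (RackColoring R D ≃ RackColoring R D') := by
  obtain ⟨φ, -, hφ, H, s, hg, hg', hn, hn', hout⟩ := h
  have hbox : (0 : R3) ∈ box := by simp [box]
  have hsrc : IsConnected φ.source := by
    rw [← φ.symm_image_target_eq_source, hφ]
    exact ⟨⟨_, mem_image_of_mem _ hbox⟩,
      isPreconnected_box.image _ (hφ ▸ φ.continuousOn_symm)⟩
  -- The height functions `H` are common to both diagrams, so one `σ` serves before and after the
  -- move.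
  obtain ⟨σ, hσ⟩ := exists_perm_strictAnti hsrc (fun i => (hg.1 i).continuousOn) hg.2.1
  have ht : |(1 / 8 : ℝ)| ≤ 1 / 8 := by rw [abs_of_pos (by norm_num)]
  have ht' : |(-1 / 8 : ℝ)| ≤ 1 / 8 := by rw [abs_of_neg (by norm_num)]; norm_num
  refine IsLocalChange.nonempty_equiv (M := core) ⟨m.isDiskModel ht hφ hg hn σ hσ,
    m.isDiskModel ht' hφ hg' hn' σ hσ, isCompact_core, hφ.symm ▸ core_subset_box,
    fun v hv hc i => ?_, fun p hp => (hout p hp).1, fun p hp => (hout p hp).2⟩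
  rw [sign_mul, sign_mul, m.sign_model_eq ht ht' (hφ ▸ hv) hc]

theorem RegularEquivalent.nonempty_equiv {D D' : Diagram} (h : RegularEquivalent D D')
    {R : Type*} [Rack R] : Nonempty (RackColoring R D ≃ RackColoring R D') := by
  induction h with
  | rel _ _ h => exact h.elim (fun h => h.nonempty_equiv) fun ⟨_, h⟩ => h.nonempty_equiv
  | refl _ => exact ⟨Equiv.refl _⟩
  | symm _ _ _ ih => exact ih.map Equiv.symm
  | trans _ _ _ _ _ ih ih' => exact ih.elim fun e => ih'.map e.trans

end SurfaceKnots

theorem theorem6p1 (D₁ D₂ : SurfaceKnots.Diagram) (h : SurfaceKnots.RegularEquivalent D₁ D₂)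
    {R : Type*} [Rack R] :
    Nonempty (SurfaceKnots.RackColoring R D₁ ≃ SurfaceKnots.RackColoring R D₂) :=
  h.nonempty_equiv
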